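/- **Setting.** Let $\Sigma$ be a finite alphabet. A (nondeterministic) *Muller automaton* over $\Sigma$ consists of a finite set $Q$ of states, a transition function $\delta_a : Q\to\mathcal P(Q)$ for each $a\in\Sigma$, a set $Q_{\mathrm{in}}\subset Q$ of initial states and a family $\mathcal A\subset\mathcal P(Q)$. A path from $q$ spelling a right-infinite word $\omega=a_1a_2\cdots$ is a sequence $\rho=(q_0,q_1,\dots)$ of states with $q_0=q$ and $q_{i}\in\delta_{a_i}(q_{i-1})$ for all $i\ge 1$ (similarly for finite words); $\mathrm{Inf}(\rho)$ is the set of states that occur infinitely often in $\rho$. The automaton accepts $\omega$ *from* $q$ if some path $\rho$ from $q$ spelling $\omega$ has $\mathrm{Inf}(\rho)\in\mathcal A$, and it accepts $\omega$ if it accepts $\omega$ from some $q\in Q_{\mathrm{in}}$. Let $\mathrm{Cob}^{\mathsf h}_\Sigma$ be the symmetric monoidal category whose objects are finite sequences of signs $\pm$ (oriented 0-manifolds, tensor product given by concatenation) and whose morphisms are homeomorphism classes, rel boundary, of compact oriented one-dimensional cobordisms decorated as follows. Finitely many boundary points of the 1-manifold may lie in the interior of the cobordism ("inner endpoints"). The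 1-manifold carries a discrete set of points (defects) labelled by elements of $\Sigma$. Defects accumulate precisely at the inner endpoints at which the orientation points out of the 1-manifold. Thus a component ending at such an endpoint carries a right-infinite word, read along the orientation, and any other component carries a finite word (a cyclic one on a circle). Composition is gluing and the tensor product is disjoint union. Let $\mathbb B=\{0,1\mid 1+1=1\}$ be the Boolean semiring and $\mathbb B\text{-}\mathrm{fmod}$ the symmetric monoidal category of free $\mathbb B$-semimodules. A *Boolean TQFT* is a symmetric (strong) monoidal functor $\mathrm{Cob}^{\mathsf h}_\Sigma\to\mathbb B\text{-}\mathrm{fmod}$. **Proposition.** A Muller automaton $(Q,\delta,Q_{\mathrm{in}},\mathcal A)$ over $\Sigma$ determines a Boolean TQFT. That is, there is a symmetric monoidal functor $$\mathcal F:\mathrm{Cob}^{\mathsf h}_\Sigma\longrightarrow \mathbb B\text{-}\mathrm{fmod},$$ such that $\mathcal F(+)$ is free with a basis $\{q\}_{q\in Q}$, $\mathcal F(-)$ is free with a basis $\{q^*\}_{q\in Q}$, and, up to the structure isomorphisms of $\mathcal F$: 1. the cup $\emptyset\to{+}{-}$ without defects is $\sum_{q\in Q}q\otimes q^*$, and the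 caps ${+}{-}\to\emptyset$ and ${-}{+}\to\emptyset$ without defects send $q_1\otimes q_2^*$, respectively $q_1^*\otimes q_2$, to $1$ if $q_1=q_2$ and to $0$ otherwise; 2. a strand over $+$ with one defect $a\in\Sigma$ acts on $\mathcal F(+)$ by $q\mapsto\sum_{q'\in\delta_a(q)}q'$, and a strand over $-$ with one defect $a$ acts on $\mathcal F(-)$ by the dual map $(q')^*\mapsto\sum_{q:\,q'\in\delta_a(q)}q^*$; 3. the interval from an inner endpoint to a top point $+$ that carries a finite word $w$ is the vector $\sum q\in\mathcal F(+)$, where $q$ ranges over the states that are reached from $Q_{\mathrm{in}}$ by a path spelling $w$ (for the empty word, over $Q_{\mathrm{in}}$); 4. the interval from a bottom point $+$ to an inner endpoint that carries a right-infinite word $\omega$ is the functional $\gamma_\omega:\mathcal F(+)\to\mathbb B$ with $\gamma_\omega(q)=1$ if and only if the automaton accepts $\omega$ from $q$; and the interval from a top point $-$ to an inner endpoint that carries $\omega$ is the vector $\sum_{q:\,\gamma_\omega(q)=1}q^*\in\mathcal F(-)$; 5. a floating interval that carries a right-infinite word $\omega$ evaluates to $1\in\mathbb B$ if and only if the Muller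 automaton accepts $\omega$; 6. a floating circle that carries a finite word $w$ evaluates to $1$ if and only if the automaton has a closed path spelling $w$, i.e. a path spelling $w$ from some state $q$ to $q$ (for the empty word: if and only if $Q\neq\emptyset$). -/

import Mathlib

open CategoryTheory MonoidalCategory

namespace MullerTQFT

/-- A one-dimensional oriented manifold with defects labelled by `A`, cut into finitely many
oriented segments. The outer endpoints are the set `S` of sources (at which the orientation points
into the manifold) and the set `T` of targets (at which it points out of the manifold). `J` is the
set of junctions, that is, interior points without defect at which the manifold is cut, and `O` is
the set of inner endpoints at which the orientation points out of the manifold.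

Each segment ends at exactly one element of `T`, `J` or `O`, and is indexed by it. A segment which
ends in `T` or `J` carries a finite word, a segment which ends in `O` carries a right-infinite word
(its defects accumulate towards the end). Words are read along the orientation.

`next a` is the segment which starts at the point `a` of `S` or `J`. The segments that are not of
the form `next a` start at an inner endpoint at which the orientation points into the manifold. -/
structure Diagram (A S T J O : Type) where
  next : S ⊕ J → (T ⊕ J) ⊕ O
  next_injective : Function.Injective next
  word : T ⊕ J → List A
  ray : O → Stream' A

namespace Diagram

variable {A S T S' T' S'' T'' J O J' O' J'' O'' K M N : Type}

/-- The word carried by a segment. -/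
def label (P : Diagram A S T J O) : (T ⊕ J) ⊕ O → List A ⊕ Stream' A :=
  Sum.map P.word P.ray

/-- Concatenation of a finite word with a finite or right-infinite word. -/
def prefixLabel (u : List A) : List A ⊕ Stream' A → List A ⊕ Stream' A :=
  Sum.map (u ++ ·) (u ++ₛ ·)

/-- `R` arises from `P` by cutting some of its segments at one point each: for every `k : K` the
segment `cut k` of `P` is cut by a new junction `eJ (inr k)` into an initial part, which ends at the
new junction, and a final part, which has the same end as before; the word of `cut k` is the
concatenation of the words of the two parts. The other segments are unchanged. (If `K` is empty,
this is an isomorphism of diagrams.) -/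
structure IsSubdivision (P : Diagram A S T J O) (R : Diagram A S T J' O')
    (eJ : J ⊕ K ≃ J') (eO : O ≃ O') (cut : K → (T ⊕ J) ⊕ O) : Prop where
  next_cut : ∀ a k, P.next a = cut k →
    R.next (Sum.map id (eJ ∘ Sum.inl) a) = Sum.inl (Sum.inr (eJ (Sum.inr k)))
  next_new : ∀ k, R.next (Sum.inr (eJ (Sum.inr k))) =
    Sum.map (Sum.map id (eJ ∘ Sum.inl)) eO (cut k)
  next_old : ∀ a, (∀ k, P.next a ≠ cut k) →
    R.next (Sum.map id (eJ ∘ Sum.inl) a) = Sum.map (Sum.map id (eJ ∘ Sum.inl)) eO (P.next a)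
  label_cut : ∀ k, P.label (cut k) = prefixLabel (R.word (Sum.inr (eJ (Sum.inr k))))
    (R.label (Sum.map (Sum.map id (eJ ∘ Sum.inl)) eO (cut k)))
  label_old : ∀ e, (∀ k, e ≠ cut k) →
    P.label e = R.label (Sum.map (Sum.map id (eJ ∘ Sum.inl)) eO e)

/-- Renaming of the outer endpoints. -/
def relabel (s : S ≃ S') (t : T ≃ T') (P : Diagram A S T J O) : Diagram A S' T' J O where
  next a := Sum.map (Sum.map t id) id (P.next (Sum.map s.symm id a))
  next_injective := by
    intro a b h
    have h1 := P.next_injective ((Function.Injective.sumMap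
      (t.injective.sumMap Function.injective_id) Function.injective_id) h)
    exact (s.symm.injective.sumMap Function.injective_id) h1
  word e := P.word (Sum.map t.symm id e)
  ray := P.ray

/-- Disjoint union. -/
def disj (P : Diagram A S T J O) (R : Diagram A S' T' J' O') :
    Diagram A (S ⊕ S') (T ⊕ T') (J ⊕ J') (O ⊕ O') where
  next a := Sum.elim (Sum.map (Sum.map Sum.inl Sum.inl) Sum.inl ∘ P.next)
    (Sum.map (Sum.map Sum.inr Sum.inr) Sum.inr ∘ R.next) (Equiv.sumSumSumComm S S' J J' a)
  next_injective := by
    refine Function.Injective.comp (Function.Injective.sumElim ?_ ?_ ?_) (Equiv.injective _)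
    · exact ((Sum.inl_injective.sumMap Sum.inl_injective).sumMap Sum.inl_injective).comp
        P.next_injective
    · exact ((Sum.inr_injective.sumMap Sum.inr_injective).sumMap Sum.inr_injective).comp
        R.next_injective
    · intro a b
      simp only [Function.comp_apply]
      rcases P.next a with (_ | _) | _ <;> rcases R.next b with (_ | _) | _ <;> simp
  word e := Sum.elim P.word R.word (Equiv.sumSumSumComm T T' J J' e)
  ray := Sum.elim P.ray R.ray

/-- `(S ⊕ M) ⊕ J ≃ S ⊕ (J ⊕ M)`. -/
def regroup (S M J : Type) : (S ⊕ M) ⊕ J ≃ S ⊕ (J ⊕ M) where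
  toFun := Sum.elim (Sum.elim Sum.inl (Sum.inr ∘ Sum.inr)) (Sum.inr ∘ Sum.inl)
  invFun := Sum.elim (Sum.inl ∘ Sum.inl) (Sum.elim Sum.inr (Sum.inl ∘ Sum.inr))
  left_inv := by rintro ((_ | _) | _) <;> rfl
  right_inv := by rintro (_ | _ | _) <;> rfl

/-- Gluing each target `m : M` to the source `m : M`, which turns it into a junction. -/
def glue (P : Diagram A (S ⊕ M) (T ⊕ M) J O) : Diagram A S T (J ⊕ M) O where
  next a := Sum.map (regroup T M J) id (P.next ((regroup S M J).symm a))
  next_injective := by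
    intro a b h
    exact (regroup S M J).symm.injective (P.next_injective
      (((regroup T M J).injective.sumMap Function.injective_id) h))
  word e := P.word ((regroup T M J).symm e)
  ray := P.ray

/-- A disjoint union of arcs between outer endpoints: the arc that starts at `s` ends at `e s`, and
the arc that ends at `t` carries the word `w t`. -/
def arcs (e : S ≃ T) (w : T → List A) : Diagram A S T Empty Empty where
  next := Sum.inl ∘ Sum.map e id
  next_injective := Sum.inl_injective.comp (e.injective.sumMap Function.injective_id)
  word := Sum.elim w Empty.elim
  ray := Empty.elim

section lemmas

variable {P : Diagram A S T J O} {R : Diagram A S T J' O'}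
    {eJ : J ⊕ K ≃ J'} {eO : O ≃ O'} {cut : K → (T ⊕ J) ⊕ O}

theorem isSubdivision_of_equiv (eJ : J ≃ J') (eO : O ≃ O')
    (hs : ∀ a, R.next (Sum.map id eJ a) = Sum.map (Sum.map id eJ) eO (P.next a))
    (hl : ∀ e, P.word e = R.word (Sum.map id eJ e)) (hr : ∀ o, P.ray o = R.ray (eO o)) :
    IsSubdivision (K := Empty) P R ((Equiv.sumEmpty J Empty).trans eJ) eO Empty.elim where
  next_cut := fun _ k => k.elim
  next_new := fun k => k.elim
  next_old := fun a _ => hs a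
  label_cut := fun k => k.elim
  label_old := fun e _ => by
    rcases e with e | o
    · exact congrArg Sum.inl (hl e)
    · exact congrArg Sum.inr (hr o)

theorem IsSubdivision.relabel (h : IsSubdivision P R eJ eO cut) (s : S ≃ S') (t : T ≃ T') :
    IsSubdivision (P.relabel s t) (R.relabel s t) eJ eO
      (fun k => Sum.map (Sum.map t id) id (cut k)) where
  next_cut := by
    intro a k hk
    have hi : Function.Injective (Sum.map (Sum.map t (id : J → J)) (id : O → O)) :=
      (t.injective.sumMap Function.injective_id).sumMap Function.injective_id
    have := h.next_cut (Sum.map s.symm id a) k (hi hk)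
    rcases a with a | a <;> simp_all [Diagram.relabel]
  next_new := by
    intro k
    have := h.next_new k
    simp only [Diagram.relabel, Sum.map_inr, id, this]
    rcases cut k with (x | x) | x <;> simp
  next_old := by
    intro a ha
    have := h.next_old (Sum.map s.symm id a) (fun k hk => ha k (by
      simp only [Diagram.relabel, hk]))
    have e1 : Sum.map s.symm id (Sum.map id (eJ ∘ Sum.inl) a)
      = Sum.map id (eJ ∘ Sum.inl) (Sum.map s.symm id a) := by rcases a with a | a <;> rfl
    simp only [Diagram.relabel, e1, this]
    rcases P.next (Sum.map s.symm id a) with (x | x) | x <;> simp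
  label_cut := by
    intro k
    have := h.label_cut k
    revert this
    rcases cut k with (x | x) | x <;> simp [Diagram.relabel, Diagram.label]
  label_old := by
    intro e he
    have := h.label_old (Sum.map (Sum.map t.symm id) id e) (fun k hk => he k (by
      rw [← hk]; rcases e with (x | x) | x <;> simp))
    revert this
    rcases e with (x | x) | x <;> simp [Diagram.relabel, Diagram.label]

def glueEquiv (eJ : J ⊕ K ≃ J') (M : Type) : (J ⊕ M) ⊕ K ≃ J' ⊕ M where
  toFun := Sum.elim (Sum.map (eJ ∘ Sum.inl) id) (Sum.inl ∘ eJ ∘ Sum.inr)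
  invFun := Sum.elim (Sum.map Sum.inl id ∘ eJ.symm) (Sum.inl ∘ Sum.inr)
  left_inv := by rintro ((_ | _) | _) <;> simp
  right_inv := by
    rintro (x | _)
    · obtain ⟨y, rfl⟩ := eJ.surjective x
      rcases y with y | y <;> simp
    · simp

theorem IsSubdivision.glue {P : Diagram A (S ⊕ M) (T ⊕ M) J O}
    {R : Diagram A (S ⊕ M) (T ⊕ M) J' O'} {cut : K → ((T ⊕ M) ⊕ J) ⊕ O}
    (h : IsSubdivision P R eJ eO cut) :
    IsSubdivision P.glue R.glue (glueEquiv eJ M) eO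
      (fun k => Sum.map (regroup T M J) id (cut k)) where
  next_cut := by
    intro a k hk
    have hi : Function.Injective (Sum.map (regroup T M J) (id : O → O)) :=
      (Equiv.injective _).sumMap Function.injective_id
    have := h.next_cut _ k (hi hk)
    rcases a with a | a | a <;> simp_all [Diagram.glue, regroup, glueEquiv]
  next_new := by
    intro k
    have := h.next_new k
    simp only [Diagram.glue]
    simp [regroup, glueEquiv, this]
    rcases cut k with ((x | x) | x) | x <;> simp
  next_old := by
    intro a ha
    have := h.next_old ((regroup S M J).symm a) (fun k hk => ha k (by
      simp only [Diagram.glue, hk]))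
    have e1 : (regroup S M J').symm (Sum.map id (glueEquiv eJ M ∘ Sum.inl) a)
      = Sum.map id (eJ ∘ Sum.inl) ((regroup S M J).symm a) := by
        rcases a with a | a | a <;> rfl
    simp only [Diagram.glue, e1, this]
    rcases P.next ((regroup S M J).symm a) with ((x | x) | x) | x <;> simp [regroup, glueEquiv]
  label_cut := by
    intro k
    have := h.label_cut k
    revert this
    rcases cut k with ((x | x) | x) | x <;> simp [Diagram.glue, Diagram.label, regroup, glueEquiv]
  label_old := by
    intro e he
    have := h.label_old (Sum.map (regroup T M J).symm id e) (fun k hk => he k (by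
      rw [← hk]; rcases e with (x | x) | x <;> simp))
    revert this
    rcases e with (x | x | x) | x <;> simp [Diagram.glue, Diagram.label, regroup, glueEquiv]

theorem IsSubdivision.disj_right (h : IsSubdivision P R eJ eO cut)
    (D : Diagram A S' T' J'' O'') :
    IsSubdivision (P.disj D) (R.disj D) (glueEquiv eJ J'') (eO.sumCongr (Equiv.refl _))
      (fun k => Sum.map (Sum.map Sum.inl Sum.inl) Sum.inl (cut k)) where
  next_cut := by
    rintro a k hk
    have hi : Function.Injective (Sum.map (Sum.map (Sum.inl : T → T ⊕ T') (Sum.inl : J → J ⊕ J''))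
        (Sum.inl : O → O ⊕ O'')) :=
      ((Sum.inl_injective.sumMap Sum.inl_injective).sumMap Sum.inl_injective)
    rcases a with (a | a) | (a | a)
    · have := h.next_cut _ k (hi hk)
      simp_all [Diagram.disj, glueEquiv, Equiv.sumSumSumComm]
    · exfalso
      revert hk
      simp only [Diagram.disj, Equiv.sumSumSumComm]
      simp
      rcases D.next (Sum.inl a) with (_ | _) | _ <;> rcases cut k with (_ | _) | _ <;> simp
    · have := h.next_cut _ k (hi hk)
      simp_all [Diagram.disj, glueEquiv, Equiv.sumSumSumComm]
    · exfalso
      revert hk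
      simp only [Diagram.disj, Equiv.sumSumSumComm]
      simp
      rcases D.next (Sum.inr a) with (_ | _) | _ <;> rcases cut k with (_ | _) | _ <;> simp
  next_new := by
    intro k
    have := h.next_new k
    simp only [Diagram.disj]
    simp [Equiv.sumSumSumComm, glueEquiv, this]
    rcases cut k with (x | x) | x <;> simp
  next_old := by
    intro a ha
    rcases a with (a | a) | (a | a)
    · have := h.next_old (Sum.inl a) (fun k hk => ha k (by
        simp [Diagram.disj, Equiv.sumSumSumComm, hk]))
      simp_all [Diagram.disj, Equiv.sumSumSumComm]
      rcases P.next (Sum.inl a) with (x | x) | x <;> simp [glueEquiv]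
    · simp [Diagram.disj, Equiv.sumSumSumComm]
      rcases D.next (Sum.inl a) with (x | x) | x <;> simp [glueEquiv]
    · have := h.next_old (Sum.inr a) (fun k hk => ha k (by
        simp [Diagram.disj, Equiv.sumSumSumComm, hk]))
      simp_all [Diagram.disj, Equiv.sumSumSumComm, glueEquiv]
      rcases P.next (Sum.inr a) with (x | x) | x <;> simp
    · simp [Diagram.disj, Equiv.sumSumSumComm, glueEquiv]
      rcases D.next (Sum.inr a) with (x | x) | x <;> simp
  label_cut := by
    intro k
    have := h.label_cut k
    revert this
    rcases cut k with (x | x) | x <;>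
      simp [Diagram.disj, Diagram.label, Equiv.sumSumSumComm, glueEquiv]
  label_old := by
    intro e he
    rcases e with ((e | e) | (e | e)) | (e | e)
    · have := h.label_old (Sum.inl (Sum.inl e)) (fun k hk => he k (by simp [← hk]))
      simpa [Diagram.disj, Diagram.label, Equiv.sumSumSumComm, glueEquiv] using this
    · simp [Diagram.disj, Diagram.label, Equiv.sumSumSumComm, glueEquiv]
    · have := h.label_old (Sum.inl (Sum.inr e)) (fun k hk => he k (by simp [← hk]))
      simpa [Diagram.disj, Diagram.label, Equiv.sumSumSumComm, glueEquiv] using this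
    · simp [Diagram.disj, Diagram.label, Equiv.sumSumSumComm, glueEquiv]
    · have := h.label_old (Sum.inr e) (fun k hk => he k (by simp [← hk]))
      simpa [Diagram.disj, Diagram.label, Equiv.sumSumSumComm, glueEquiv] using this
    · simp [Diagram.disj, Diagram.label, Equiv.sumSumSumComm, glueEquiv]

end lemmas
end Diagram

/-- A diagram with finitely many segments, with its sets of junctions and endpoints. -/
structure Presentation (A S T : Type) where
  J : Type
  O : Type
  [finite_J : Finite J]
  [finite_O : Finite O]
  diagram : Diagram A S T J O

attribute [instance] Presentation.finite_J Presentation.finite_O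

/-- `R` is a subdivision of `P`. -/
def Presentation.Refines {A S T : Type} (P R : Presentation A S T) : Prop :=
  ∃ (K : Type) (eJ : P.J ⊕ K ≃ R.J) (eO : P.O ≃ R.O) (cut : K → (T ⊕ P.J) ⊕ P.O),
    P.diagram.IsSubdivision R.diagram eJ eO cut

/-- Homeomorphism classes (relative to the outer endpoints) of compact oriented one-manifolds with
`A`-labelled defects, sources `S` and targets `T`, such that infinitely many defects accumulate
towards each inner endpoint that is oriented out of the manifold, and nowhere else: diagrams up to
the equivalence relation generated by isomorphism and subdivision. -/
def Cobordism (A S T : Type) : Type 1 := Quot (@Presentation.Refines A S T)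

namespace Cobordism

variable {A S T S' T' S'' T'' J O J' O' J'' O'' K M N : Type}

/-- The class of a diagram. -/
def mk [Finite J] [Finite O] (D : Diagram A S T J O) : Cobordism A S T := Quot.mk _ ⟨J, O, D⟩

theorem ind {p : Cobordism A S T → Prop}
    (h : ∀ (J O : Type) [Finite J] [Finite O] (D : Diagram A S T J O), p (mk D)) (f) : p f := by
  obtain ⟨⟨J, O, D⟩⟩ := f
  exact h J O D

theorem sound [Finite J] [Finite O] [Finite J'] [Finite O'] {P : Diagram A S T J O}
    {R : Diagram A S T J' O'} {eJ : J ⊕ K ≃ J'} {eO : O ≃ O'} {cut : K → (T ⊕ J) ⊕ O}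
    (h : P.IsSubdivision R eJ eO cut) : mk P = mk R :=
  Quot.sound ⟨K, eJ, eO, cut, h⟩

theorem mk_eq_of_equiv [Finite J] [Finite O] [Finite J'] [Finite O'] {P : Diagram A S T J O}
    {R : Diagram A S T J' O'} (eJ : J ≃ J') (eO : O ≃ O')
    (hs : ∀ a, R.next (Sum.map id eJ a) = Sum.map (Sum.map id eJ) eO (P.next a))
    (hl : ∀ e, P.word e = R.word (Sum.map id eJ e)) (hr : ∀ o, P.ray o = R.ray (eO o)) :
    mk P = mk R :=
  sound (Diagram.isSubdivision_of_equiv eJ eO hs hl hr)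

/-- Renaming of the outer endpoints. -/
def relabel (s : S ≃ S') (t : T ≃ T') : Cobordism A S T → Cobordism A S' T' :=
  Quot.lift (fun P => mk (P.diagram.relabel s t))
    (fun _ _ ⟨_, _, _, _, h⟩ => sound (h.relabel s t))

/-- Gluing the targets `M` to the sources `M`. -/
def glue [Finite M] : Cobordism A (S ⊕ M) (T ⊕ M) → Cobordism A S T :=
  Quot.lift (fun P => mk P.diagram.glue) (fun _ _ ⟨_, _, _, _, h⟩ => sound h.glue)

theorem mk_disj_comm [Finite J] [Finite O] [Finite J'] [Finite O'] (P : Diagram A S T J O)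
    (R : Diagram A S' T' J' O') : mk (R.disj P) =
      relabel (Equiv.sumComm S S') (Equiv.sumComm T T') (mk (P.disj R)) := by
  refine mk_eq_of_equiv (Equiv.sumComm _ _) (Equiv.sumComm _ _) ?_ ?_ ?_
  · rintro ((a | a) | (a | a)) <;>
      simp only [Diagram.relabel, Diagram.disj, Equiv.sumSumSumComm] <;> simp
    · rcases R.next (Sum.inl a) with (x | x) | x <;> simp
    · rcases P.next (Sum.inl a) with (x | x) | x <;> simp
    · rcases R.next (Sum.inr a) with (x | x) | x <;> simp
    · rcases P.next (Sum.inr a) with (x | x) | x <;> simp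
  · rintro ((a | a) | (a | a)) <;> rfl
  · rintro (a | a) <;> rfl

/-- Disjoint union. -/
def disj : Cobordism A S T → Cobordism A S' T' → Cobordism A (S ⊕ S') (T ⊕ T') :=
  Quot.lift₂ (fun P R => mk (P.diagram.disj R.diagram))
    (fun P _ _ ⟨_, _, _, _, h⟩ => by
      rw [mk_disj_comm, mk_disj_comm _ P.diagram]
      exact congrArg _ (sound (h.disj_right _)))
    (fun _ _ R ⟨_, _, _, _, h⟩ => sound (h.disj_right R.diagram))

/-- Disjoint union of arcs. -/
def arcs (e : S ≃ T) (w : T → List A) : Cobordism A S T := mk (Diagram.arcs e w)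

theorem disj_comm (f : Cobordism A S T) (g : Cobordism A S' T') :
    disj g f = relabel (Equiv.sumComm S S') (Equiv.sumComm T T') (disj f g) := by
  induction f using ind with | _ J O P
  induction g using ind with | _ J' O' R
  exact mk_disj_comm P R

theorem relabel_refl (f : Cobordism A S T) : relabel (Equiv.refl S) (Equiv.refl T) f = f := by
  induction f using ind with | _ J O P
  refine mk_eq_of_equiv (Equiv.refl _) (Equiv.refl _) ?_ ?_ ?_
  · rintro (a | a) <;> simp [Diagram.relabel]
  · rintro (a | a) <;> rfl
  · intro o; rfl

theorem relabel_relabel (s : S ≃ S') (s' : S' ≃ S'') (t : T ≃ T') (t' : T' ≃ T'')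
    (f : Cobordism A S T) :
    relabel s' t' (relabel s t f) = relabel (s.trans s') (t.trans t') f := by
  induction f using ind with | _ J O P
  refine mk_eq_of_equiv (Equiv.refl _) (Equiv.refl _) ?_ ?_ ?_
  · rintro (a | a) <;> simp [Diagram.relabel]
  · rintro (a | a) <;> rfl
  · intro o; rfl

theorem disj_relabel {S₁ T₁ S₂ T₂ : Type} (s : S ≃ S') (t : T ≃ T') (s' : S₁ ≃ S₂) (t' : T₁ ≃ T₂)
    (f : Cobordism A S T) (g : Cobordism A S₁ T₁) :
    disj (relabel s t f) (relabel s' t' g) =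
      relabel (s.sumCongr s') (t.sumCongr t') (disj f g) := by
  induction f using ind with | _ J O P
  induction g using ind with | _ J' O' R
  refine mk_eq_of_equiv (Equiv.refl _) (Equiv.refl _) ?_ ?_ ?_
  · rintro ((a | a) | (a | a)) <;>
      simp only [Diagram.relabel, Diagram.disj, Equiv.sumSumSumComm] <;> simp
    · rcases P.next _ with (x | x) | x <;> simp
    · rcases R.next _ with (x | x) | x <;> simp
    · rcases P.next _ with (x | x) | x <;> simp
    · rcases R.next _ with (x | x) | x <;> simp
  · rintro ((a | a) | (a | a)) <;> rfl
  · rintro (a | a) <;> rfl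

theorem disj_assoc (f : Cobordism A S T) (g : Cobordism A S' T') (h : Cobordism A S'' T'') :
    disj f (disj g h) =
      relabel (Equiv.sumAssoc S S' S'') (Equiv.sumAssoc T T' T'') (disj (disj f g) h) := by
  induction f using ind with | _ J O P
  induction g using ind with | _ J' O' R
  induction h using ind with | _ J'' O'' Q
  refine Eq.symm (mk_eq_of_equiv (Equiv.sumAssoc _ _ _) (Equiv.sumAssoc _ _ _) ?_ ?_ ?_)
  · rintro ((a | a | a) | ((a | a) | a)) <;>
      simp only [Diagram.relabel, Diagram.disj, Equiv.sumSumSumComm] <;> simp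
    · rcases P.next _ with (x | x) | x <;> simp
    · rcases R.next _ with (x | x) | x <;> simp
    · rcases Q.next _ with (x | x) | x <;> simp
    · rcases P.next _ with (x | x) | x <;> simp
    · rcases R.next _ with (x | x) | x <;> simp
    · rcases Q.next _ with (x | x) | x <;> simp
  · rintro ((a | a | a) | ((a | a) | a)) <;> rfl
  · rintro ((a | a) | a) <;> rfl

theorem disj_disj_disj_comm {S₁ T₁ S₂ T₂ S₃ T₃ S₄ T₄ : Type} (f : Cobordism A S₁ T₁)
    (g : Cobordism A S₂ T₂) (h : Cobordism A S₃ T₃) (k : Cobordism A S₄ T₄) :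
    disj (disj f h) (disj g k) = relabel (Equiv.sumSumSumComm _ _ _ _)
      (Equiv.sumSumSumComm _ _ _ _) (disj (disj f g) (disj h k)) := by
  induction f using ind with | _ J₁ O₁ P₁
  induction g using ind with | _ J₂ O₂ P₂
  induction h using ind with | _ J₃ O₃ P₃
  induction k using ind with | _ J₄ O₄ P₄
  refine Eq.symm (mk_eq_of_equiv (Equiv.sumSumSumComm _ _ _ _) (Equiv.sumSumSumComm _ _ _ _) ?_ ?_ ?_)
  · rintro (((a | a) | (a | a)) | ((a | a) | (a | a))) <;>
      simp only [Diagram.relabel, Diagram.disj, Equiv.sumSumSumComm] <;> simp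
    · rcases P₁.next _ with (x | x) | x <;> simp
    · rcases P₃.next _ with (x | x) | x <;> simp
    · rcases P₂.next _ with (x | x) | x <;> simp
    · rcases P₄.next _ with (x | x) | x <;> simp
    · rcases P₁.next _ with (x | x) | x <;> simp
    · rcases P₂.next _ with (x | x) | x <;> simp
    · rcases P₃.next _ with (x | x) | x <;> simp
    · rcases P₄.next _ with (x | x) | x <;> simp
  · rintro (((a | a) | (a | a)) | ((a | a) | (a | a))) <;> rfl
  · rintro ((a | a) | (a | a)) <;> rfl

theorem glue_relabel [Finite M] [Finite N] (s : S ≃ S') (t : T ≃ T') (m : M ≃ N)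
    (f : Cobordism A (S ⊕ M) (T ⊕ M)) :
    glue (relabel (s.sumCongr m) (t.sumCongr m) f) = relabel s t (glue f) := by
  induction f using ind with | _ J O P
  refine Eq.symm (mk_eq_of_equiv ((Equiv.refl _).sumCongr m) (Equiv.refl _) ?_ ?_ ?_)
  · rintro (a | a | a) <;>
      simp only [Diagram.relabel, Diagram.glue, Diagram.regroup] <;> simp
    · rcases P.next _ with ((x | x) | x) | x <;> simp
    · rcases P.next _ with ((x | x) | x) | x <;> simp
    · rcases P.next _ with ((x | x) | x) | x <;> simp
  · rintro (a | a | a) <;> simp [Diagram.relabel, Diagram.glue, Diagram.regroup]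
  · intro o; rfl

theorem glue_glue [Finite M] [Finite N] (f : Cobordism A ((S ⊕ M) ⊕ N) ((T ⊕ M) ⊕ N)) :
    glue (glue f) = glue (relabel (Equiv.sumAssoc S M N) (Equiv.sumAssoc T M N) f) := by
  induction f using ind with | _ J O P
  refine mk_eq_of_equiv
    ((Equiv.sumAssoc _ _ _).trans ((Equiv.refl _).sumCongr (Equiv.sumComm _ _))) (Equiv.refl _)
    ?_ ?_ ?_
  · rintro (a | (a | a) | a) <;>
      simp only [Diagram.relabel, Diagram.glue, Diagram.regroup] <;> simp
    · rcases P.next _ with (((x | x) | x) | x) | x <;> simp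
    · rcases P.next _ with (((x | x) | x) | x) | x <;> simp
    · rcases P.next _ with (((x | x) | x) | x) | x <;> simp
    · rcases P.next _ with (((x | x) | x) | x) | x <;> simp
  · rintro (a | (a | a) | a) <;> rfl
  · intro o; rfl

/-- `(a ⊕ m) ⊕ b ≃ (a ⊕ b) ⊕ m`. -/
def swapRight (a m b : Type) : (a ⊕ m) ⊕ b ≃ (a ⊕ b) ⊕ m where
  toFun := Sum.elim (Sum.map Sum.inl id) (Sum.inl ∘ Sum.inr)
  invFun := Sum.elim (Sum.map Sum.inl id) (Sum.inl ∘ Sum.inr)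
  left_inv := by rintro ((_ | _) | _) <;> rfl
  right_inv := by rintro ((_ | _) | _) <;> rfl

theorem disj_glue [Finite M] (f : Cobordism A (S ⊕ M) (T ⊕ M)) (g : Cobordism A S' T') :
    disj (glue f) g = glue (relabel (swapRight S M S') (swapRight T M T') (disj f g)) := by
  induction f using ind with | _ J O P
  induction g using ind with | _ J' O' R
  refine mk_eq_of_equiv (swapRight _ _ _) (Equiv.refl _) ?_ ?_ ?_
  · rintro ((a | a) | ((a | a) | a)) <;>
      simp only [Diagram.relabel, Diagram.glue, Diagram.regroup, Diagram.disj, swapRight,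
        Equiv.sumSumSumComm] <;> simp
    · rcases P.next _ with ((x | x) | x) | x <;> simp
    · rcases R.next _ with (x | x) | x <;> simp
    · rcases P.next _ with ((x | x) | x) | x <;> simp
    · rcases P.next _ with ((x | x) | x) | x <;> simp
    · rcases R.next _ with (x | x) | x <;> simp
  · rintro ((a | a) | ((a | a) | a)) <;> rfl
  · rintro (a | a) <;> rfl

theorem relabel_arcs (s : S ≃ S') (t : T ≃ T') (e : S ≃ T) (w : T → List A) :
    relabel s t (arcs e w) = arcs ((s.symm.trans e).trans t) (w ∘ t.symm) := by
  refine mk_eq_of_equiv (Equiv.refl _) (Equiv.refl _) ?_ ?_ ?_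
  · rintro (a | ⟨⟨⟩⟩)
    simp [Diagram.relabel, Diagram.arcs]
  · rintro (a | ⟨⟨⟩⟩)
    rfl
  · rintro ⟨⟩

theorem disj_arcs (e : S ≃ T) (w : T → List A) (e' : S' ≃ T') (w' : T' → List A) :
    disj (arcs e w) (arcs e' w') = arcs (e.sumCongr e') (Sum.elim w w') := by
  refine mk_eq_of_equiv (Equiv.sumEmpty _ _) (Equiv.sumEmpty _ _) ?_ ?_ ?_
  · rintro ((a | a) | ⟨⟨⟩⟩) <;>
    simp [Diagram.disj, Diagram.arcs, Equiv.sumSumSumComm]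
  · rintro ((a | a) | a)
    · rfl
    · rfl
    · rcases a with a | a <;> exact a.elim
  · rintro (⟨⟨⟩⟩ | ⟨⟨⟩⟩)

theorem glue_right [Finite M] (f : Cobordism A S (T ⊕ M)) :
    glue (relabel (Equiv.refl (S ⊕ M)) (swapRight T M M)
      (disj f (arcs (Equiv.refl M) (fun _ => [])))) = f := by
  induction f using ind with | _ J O P
  refine Eq.symm (sound (K := M) (eJ := (Equiv.refl (J ⊕ M)).trans
      ((Equiv.sumEmpty J Empty).symm.sumCongr (Equiv.refl M)))
    (eO := (Equiv.sumEmpty O Empty).symm)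
    (cut := fun m => Sum.inl (Sum.inl (Sum.inr m))) ⟨?_, ?_, ?_, ?_, ?_⟩)
  · rintro (a | a) k hk <;>
      simp only [Diagram.relabel, Diagram.glue, Diagram.regroup, Diagram.disj, swapRight,
        Equiv.sumSumSumComm, Diagram.arcs] <;> simp [hk]
  · intro k
    simp only [Diagram.relabel, Diagram.glue, Diagram.regroup, Diagram.disj, swapRight,
        Equiv.sumSumSumComm, Diagram.arcs]
    simp
  · rintro (a | a) hk <;>
      simp only [Diagram.relabel, Diagram.glue, Diagram.regroup, Diagram.disj, swapRight,
        Equiv.sumSumSumComm, Diagram.arcs] <;> revert hk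
    · simp
      rcases P.next _ with ((x | x) | x) | x <;> simp
    · simp
      rcases P.next _ with ((x | x) | x) | x <;> simp
  · intro k
    simp [Diagram.relabel, Diagram.glue, Diagram.regroup, Diagram.disj, swapRight,
        Equiv.sumSumSumComm, Diagram.arcs, Diagram.label, Diagram.prefixLabel]
  · rintro (((e | e) | e) | e) he
    · rfl
    · exact absurd rfl (he e)
    · rfl
    · rfl

theorem glue_left [Finite M] (f : Cobordism A (S ⊕ M) T) :
    glue (relabel (swapRight S M M) (Equiv.refl (T ⊕ M))
      (disj f (arcs (Equiv.refl M) (fun _ => [])))) = f := by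
  induction f using ind with | _ J O P
  refine Eq.symm (sound (K := M) (eJ := (Equiv.refl (J ⊕ M)).trans
      ((Equiv.sumEmpty J Empty).symm.sumCongr (Equiv.refl M)))
    (eO := (Equiv.sumEmpty O Empty).symm)
    (cut := fun m => P.next (Sum.inl (Sum.inr m))) ⟨?_, ?_, ?_, ?_, ?_⟩)
  · intro a k hk
    obtain rfl := P.next_injective hk
    simp only [Diagram.relabel, Diagram.glue, Diagram.regroup, Diagram.disj, swapRight,
        Equiv.sumSumSumComm, Diagram.arcs]
    simp
  · intro k
    simp only [Diagram.relabel, Diagram.glue, Diagram.regroup, Diagram.disj, swapRight,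
        Equiv.sumSumSumComm, Diagram.arcs]
    simp
    rcases P.next _ with (x | x) | x <;> simp
  · rintro ((a | a) | a) hk
    · simp only [Diagram.relabel, Diagram.glue, Diagram.regroup, Diagram.disj, swapRight,
        Equiv.sumSumSumComm, Diagram.arcs]
      simp
      rcases P.next _ with (x | x) | x <;> simp
    · exact absurd rfl (hk a)
    · simp only [Diagram.relabel, Diagram.glue, Diagram.regroup, Diagram.disj, swapRight,
        Equiv.sumSumSumComm, Diagram.arcs]
      simp
      rcases P.next _ with (x | x) | x <;> simp
  · intro k
    rcases P.next _ with (x | x) | x <;>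
    simp [Diagram.relabel, Diagram.glue, Diagram.regroup, Diagram.disj, swapRight,
        Equiv.sumSumSumComm, Diagram.arcs, Diagram.label, Diagram.prefixLabel]
  · rintro ((e | e) | e) he <;> rfl


section composition

variable {Xp Xn Yp Yn Zp Zn Wp Wn Xp' Xn' Yp' Yn' Zp' Zn' Wp' Wn' : Type}

/-- Brings the two copies `b`, `c` of middle sources to the right. -/
def srcEquiv (a b c d : Type) : (a ⊕ b) ⊕ (c ⊕ d) ≃ (a ⊕ d) ⊕ (c ⊕ b) where
  toFun := Sum.elim (Sum.map Sum.inl Sum.inr) (Sum.elim (Sum.inr ∘ Sum.inl) (Sum.inl ∘ Sum.inr))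
  invFun := Sum.elim (Sum.map Sum.inl Sum.inr) (Sum.elim (Sum.inr ∘ Sum.inl) (Sum.inl ∘ Sum.inr))
  left_inv := by rintro ((_ | _) | (_ | _)) <;> rfl
  right_inv := by rintro ((_ | _) | (_ | _)) <;> rfl

/-- Brings the two copies `b`, `c` of middle targets to the right. -/
def tgtEquiv (a b c d : Type) : (a ⊕ b) ⊕ (c ⊕ d) ≃ (a ⊕ d) ⊕ (b ⊕ c) where
  toFun := Sum.elim (Sum.map Sum.inl Sum.inl) (Sum.elim (Sum.inr ∘ Sum.inr) (Sum.inl ∘ Sum.inr))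
  invFun := Sum.elim (Sum.map Sum.inl Sum.inr) (Sum.elim (Sum.inl ∘ Sum.inr) (Sum.inr ∘ Sum.inl))
  left_inv := by rintro ((_ | _) | (_ | _)) <;> rfl
  right_inv := by rintro ((_ | _) | (_ | _)) <;> rfl

/-- Composition of a cobordism `f` from `(Xp, Xn)` to `(Yp, Yn)` with a cobordism `g` from `(Yp, Yn)`
to `(Zp, Zn)`, where `p` and `n` stand for the positive and the negative points: the sources of `f`
are `Xp` and `Yn`, its targets are `Xn` and `Yp`. The targets `Yp` of `f` are glued to the sources
`Yp` of `g`, and the targets `Yn` of `g` are glued to the sources `Yn` of `f`. -/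
def comp [Finite Yp] [Finite Yn] (f : Cobordism A (Xp ⊕ Yn) (Xn ⊕ Yp))
    (g : Cobordism A (Yp ⊕ Zn) (Yn ⊕ Zp)) : Cobordism A (Xp ⊕ Zn) (Xn ⊕ Zp) :=
  glue (relabel (srcEquiv Xp Yn Yp Zn) (tgtEquiv Xn Yp Yn Zp) (disj f g))

/-- The cylinder of a sign-preserving bijection: vertical strands without defects. -/
def cyl (p : Xp ≃ Yp) (n : Xn ≃ Yn) : Cobordism A (Xp ⊕ Yn) (Xn ⊕ Yp) :=
  arcs ((Equiv.sumComm Xp Yn).trans (n.symm.sumCongr p)) (fun _ => [])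

/-- Disjoint union of cobordisms. -/
def tensor (f : Cobordism A (Xp ⊕ Yn) (Xn ⊕ Yp)) (g : Cobordism A (Xp' ⊕ Yn') (Xn' ⊕ Yp')) :
    Cobordism A ((Xp ⊕ Xp') ⊕ (Yn ⊕ Yn')) ((Xn ⊕ Xn') ⊕ (Yp ⊕ Yp')) :=
  relabel (Equiv.sumSumSumComm Xp Yn Xp' Yn') (Equiv.sumSumSumComm Xn Yp Xn' Yp') (disj f g)

theorem relabel_congr {s s' : S ≃ S'} {t t' : T ≃ T'} (hs : ∀ x, s x = s' x)
    (ht : ∀ x, t x = t' x) (f : Cobordism A S T) : relabel s t f = relabel s' t' f := by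
  rw [Equiv.ext hs, Equiv.ext ht]

theorem relabel_glue [Finite M] (s : S ≃ S') (t : T ≃ T') (f : Cobordism A (S ⊕ M) (T ⊕ M)) :
    relabel s t (glue f) =
      glue (relabel (s.sumCongr (Equiv.refl M)) (t.sumCongr (Equiv.refl M)) f) :=
  (glue_relabel s t (Equiv.refl M) f).symm

theorem glue_move [Finite M] [Finite N] (m : M ≃ N) (f : Cobordism A (S ⊕ M) (T ⊕ M)) :
    glue f = glue (relabel ((Equiv.refl S).sumCongr m) ((Equiv.refl T).sumCongr m) f) := by
  rw [glue_relabel, relabel_refl]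

theorem disj_relabel_left (s : S ≃ S') (t : T ≃ T') (f : Cobordism A S T)
    (g : Cobordism A S'' T'') : disj (relabel s t f) g =
      relabel (s.sumCongr (Equiv.refl _)) (t.sumCongr (Equiv.refl _)) (disj f g) := by
  conv_lhs => rw [← relabel_refl g]
  rw [disj_relabel]

theorem disj_relabel_right (s : S ≃ S') (t : T ≃ T') (f : Cobordism A S T)
    (g : Cobordism A S'' T'') : disj g (relabel s t f) =
      relabel ((Equiv.refl _).sumCongr s) ((Equiv.refl _).sumCongr t) (disj g f) := by
  conv_lhs => rw [← relabel_refl g]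
  rw [disj_relabel]

theorem disj_glue_right [Finite M] (f : Cobordism A (S ⊕ M) (T ⊕ M)) (g : Cobordism A S' T') :
    disj g (glue f) = glue (relabel (Equiv.sumAssoc S' S M).symm (Equiv.sumAssoc T' T M).symm
      (disj g f)) := by
  rw [disj_comm, disj_glue, relabel_glue, relabel_relabel, disj_comm g f, relabel_relabel]
  refine congrArg glue (relabel_congr ?_ ?_ _) <;> rintro (_ | (_ | _)) <;> rfl

theorem comp_assoc [Finite Yp] [Finite Yn] [Finite Zp] [Finite Zn]
    (f : Cobordism A (Xp ⊕ Yn) (Xn ⊕ Yp)) (g : Cobordism A (Yp ⊕ Zn) (Yn ⊕ Zp))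
    (h : Cobordism A (Zp ⊕ Wn) (Zn ⊕ Wp)) : comp (comp f g) h = comp f (comp g h) := by
  unfold comp
  rw [disj_glue, disj_relabel_left, relabel_glue, glue_glue, disj_glue_right, disj_relabel_right,
    relabel_glue, glue_glue, disj_assoc]
  rw [glue_move (Equiv.sumComm (Yp ⊕ Yn) (Zp ⊕ Zn))]
  simp only [relabel_relabel]
  refine congrArg glue (relabel_congr ?_ ?_ _) <;> rintro (((_ | _) | (_ | _)) | (_ | _)) <;> rfl

theorem cyl_eq (p : Xp ≃ Yp) (n : Xn ≃ Yn) : cyl (A := A) p n =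
    relabel ((Equiv.refl _).sumCongr n) ((Equiv.sumComm Xp Xn).trans ((Equiv.refl _).sumCongr p))
      (disj (arcs (Equiv.refl Xp) (fun _ => [])) (arcs (Equiv.refl Xn) (fun _ => []))) := by
  rw [disj_arcs, relabel_arcs, cyl]
  congr 1
  · ext x; rcases x with x | x <;> simp
  · funext x; rcases x with x | x <;> simp

theorem comp_cyl [Finite Yp] [Finite Yn] (f : Cobordism A (Xp ⊕ Yn) (Xn ⊕ Yp))
    (p : Yp ≃ Zp) (n : Yn ≃ Zn) : comp f (cyl p n) =
      relabel ((Equiv.refl _).sumCongr n) ((Equiv.refl _).sumCongr p) f := by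
  conv_rhs => rw [← glue_left f]
  conv_rhs =>
    enter [3, 1, 3, 1]
    rw [← glue_right f]
  rw [disj_glue, disj_relabel_left, relabel_glue]
  simp only [relabel_relabel]
  rw [relabel_glue, glue_glue, comp, cyl_eq, disj_relabel_right, disj_assoc,
    glue_move (Equiv.sumComm Yp Yn)]
  simp only [relabel_relabel]
  refine congrArg glue (relabel_congr ?_ ?_ _) <;> rintro (((_ | _) | _) | _) <;> rfl

theorem cyl_comp [Finite Yp] [Finite Yn] (f : Cobordism A (Yp ⊕ Zn) (Yn ⊕ Zp))
    (p : Xp ≃ Yp) (n : Xn ≃ Yn) : comp (cyl p n) f =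
      relabel (p.symm.sumCongr (Equiv.refl _)) (n.symm.sumCongr (Equiv.refl _)) f := by
  have key : comp (cyl p n) f = relabel (p.symm.sumCongr (Equiv.refl _))
      (n.symm.sumCongr (Equiv.refl _)) (relabel (Equiv.sumComm _ _) (Equiv.sumComm _ _)
      (relabel (Equiv.sumComm _ _) (Equiv.sumComm _ _) f)) := by
    conv_rhs => rw [← glue_left (relabel (Equiv.sumComm Yp Zn) (Equiv.sumComm Yn Zp) f)]
    conv_rhs =>
      enter [3, 3, 1, 3, 1]
      rw [← glue_right (relabel (Equiv.sumComm Yp Zn) (Equiv.sumComm Yn Zp) f)]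
    have e : cyl (A := A) p n =
      relabel ((Equiv.sumComm Yn Yp).trans (p.symm.sumCongr (Equiv.refl _)))
        (n.symm.sumCongr (Equiv.refl _))
        (disj (arcs (Equiv.refl Yn) (fun _ => [])) (arcs (Equiv.refl Yp) (fun _ => []))) := by
      rw [disj_arcs, relabel_arcs, cyl]
      congr 1
      · ext x; rcases x with x | x <;> simp
      · funext x; rcases x with x | x <;> simp
    rw [disj_glue, disj_relabel_left, disj_relabel_left]
    simp only [relabel_relabel]
    rw [relabel_glue, relabel_relabel, disj_relabel_left, relabel_glue, glue_glue, comp, e,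
      disj_comm f, disj_relabel_right, disj_assoc]
    simp only [relabel_relabel]
    refine congrArg glue (relabel_congr ?_ ?_ _) <;> rintro (((_ | _) | _) | _) <;> rfl
  rw [key, relabel_relabel, relabel_relabel]
  refine relabel_congr ?_ ?_ _ <;> rintro (_ | _) <;> rfl

theorem tensor_cyl (p : Xp ≃ Yp) (n : Xn ≃ Yn) (p' : Xp' ≃ Yp') (n' : Xn' ≃ Yn') :
    tensor (cyl (A := A) p n) (cyl p' n') = cyl (p.sumCongr p') (n.sumCongr n') := by
  unfold tensor cyl
  rw [disj_arcs, relabel_arcs]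
  congr 1
  · ext x; rcases x with (x | x) | (x | x) <;> rfl
  · funext x; rcases x with (x | x) | (x | x) <;> rfl

theorem tensor_comp [Finite Yp] [Finite Yn] [Finite Yp'] [Finite Yn']
    (f : Cobordism A (Xp ⊕ Yn) (Xn ⊕ Yp)) (g : Cobordism A (Xp' ⊕ Yn') (Xn' ⊕ Yp'))
    (h : Cobordism A (Yp ⊕ Zn) (Yn ⊕ Zp)) (k : Cobordism A (Yp' ⊕ Zn') (Yn' ⊕ Zp')) :
    comp (tensor f g) (tensor h k) = tensor (comp f h) (comp g k) := by
  unfold comp tensor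
  rw [disj_glue, disj_glue_right, relabel_glue, relabel_glue, relabel_glue, glue_glue,
    disj_relabel, disj_relabel, disj_disj_disj_comm f g h k,
    glue_move (Equiv.sumSumSumComm Yp Yp' Yn Yn')]
  simp only [relabel_relabel]
  refine congrArg glue (relabel_congr ?_ ?_ _) <;>
    rintro (((_ | _) | (_ | _)) | ((_ | _) | (_ | _))) <;> rfl

theorem disj_arcs_empty [IsEmpty S'] [IsEmpty T'] (f : Cobordism A S T) (e : S' ≃ T')
    (w : T' → List A) : disj f (arcs e w) =
      relabel (Equiv.sumEmpty S S').symm (Equiv.sumEmpty T T').symm f := by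
  induction f using ind with | _ J O P
  refine Eq.symm (mk_eq_of_equiv (Equiv.sumEmpty _ _).symm (Equiv.sumEmpty _ _).symm ?_ ?_ ?_)
  · rintro ((a | a) | a) <;>
      simp only [Diagram.relabel, Diagram.disj, Equiv.sumSumSumComm] <;> simp
    · rcases P.next _ with (x | x) | x <;> simp
    · exact isEmptyElim a
    · rcases P.next _ with (x | x) | x <;> simp
  · rintro ((a | a) | a)
    · rfl
    · exact isEmptyElim a
    · rfl
  · intro a; rfl

end composition
end Cobordism

/-- Oriented compact `0`-manifolds: finite sets of positive and of negative points, the objects of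
a cobordism category with `A`-labelled defects. -/
structure OrientedPoints (A : Type) where
  pos : Type
  neg : Type
  [finite_pos : Finite pos]
  [finite_neg : Finite neg]

attribute [instance] OrientedPoints.finite_pos OrientedPoints.finite_neg

namespace OrientedPoints

variable {A : Type}

/-- A morphism from `X` to `Y` is a decorated one-manifold whose sources are the positive points of
`X` and the negative points of `Y`, and whose targets are the negative points of `X` and the positive
points of `Y`. -/
instance : Category (OrientedPoints A) where
  Hom X Y := Cobordism A (X.pos ⊕ Y.neg) (X.neg ⊕ Y.pos)
  id X := Cobordism.cyl (Equiv.refl X.pos) (Equiv.refl X.neg)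
  comp f g := Cobordism.comp f g
  id_comp f := by
    rw [Cobordism.cyl_comp]
    simpa using Cobordism.relabel_refl f
  comp_id f := by
    rw [Cobordism.comp_cyl]
    simpa using Cobordism.relabel_refl f
  assoc f g h := Cobordism.comp_assoc f g h

/-- The isomorphism given by the cylinder of a bijection. -/
def cylIso {X Y : OrientedPoints A} (p : X.pos ≃ Y.pos) (n : X.neg ≃ Y.neg) : X ≅ Y where
  hom := Cobordism.cyl p n
  inv := Cobordism.cyl p.symm n.symm
  hom_inv_id := by
    change Cobordism.comp _ _ = Cobordism.cyl _ _
    rw [Cobordism.comp_cyl, Cobordism.cyl, Cobordism.relabel_arcs, Cobordism.cyl]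
    congr 1
    ext x
    rcases x with x | x <;> simp
  inv_hom_id := by
    change Cobordism.comp _ _ = Cobordism.cyl _ _
    rw [Cobordism.comp_cyl, Cobordism.cyl, Cobordism.relabel_arcs, Cobordism.cyl]
    congr 1
    ext x
    rcases x with x | x <;> simp

theorem cyl_comp_cyl {X Y Z : OrientedPoints A} (p : X.pos ≃ Y.pos) (n : X.neg ≃ Y.neg)
    (p' : Y.pos ≃ Z.pos) (n' : Y.neg ≃ Z.neg) :
    (cylIso p n).hom ≫ (cylIso p' n').hom = (cylIso (p.trans p') (n.trans n')).hom := by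
  change Cobordism.comp (Cobordism.cyl _ _) (Cobordism.cyl _ _) = Cobordism.cyl _ _
  rw [Cobordism.comp_cyl, Cobordism.cyl, Cobordism.relabel_arcs, Cobordism.cyl]
  congr 1
  ext x
  rcases x with x | x <;> simp

instance : MonoidalCategoryStruct (OrientedPoints A) where
  tensorObj X Y := ⟨X.pos ⊕ Y.pos, X.neg ⊕ Y.neg⟩
  tensorUnit := ⟨Empty, Empty⟩
  tensorHom f g := Cobordism.tensor f g
  whiskerLeft X _ _ f := Cobordism.tensor (𝟙 X) f
  whiskerRight f X := Cobordism.tensor f (𝟙 X)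
  associator X Y Z := cylIso (Equiv.sumAssoc X.pos Y.pos Z.pos) (Equiv.sumAssoc X.neg Y.neg Z.neg)
  leftUnitor X := cylIso (Equiv.emptySum Empty X.pos) (Equiv.emptySum Empty X.neg)
  rightUnitor X := cylIso (Equiv.sumEmpty X.pos Empty) (Equiv.sumEmpty X.neg Empty)

instance : IsEmpty (𝟙_ (OrientedPoints A)).pos := inferInstanceAs (IsEmpty Empty)

instance : IsEmpty (𝟙_ (OrientedPoints A)).neg := inferInstanceAs (IsEmpty Empty)

theorem tensor_cylIso {X Y X' Y' : OrientedPoints A} (p : X.pos ≃ Y.pos) (n : X.neg ≃ Y.neg)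
    (p' : X'.pos ≃ Y'.pos) (n' : X'.neg ≃ Y'.neg) :
    (cylIso p n).hom ⊗ₘ (cylIso p' n').hom =
      (cylIso (X := X ⊗ X') (Y := Y ⊗ Y') (p.sumCongr p') (n.sumCongr n')).hom :=
  Cobordism.tensor_cyl _ _ _ _

theorem id_eq_cylIso (X : OrientedPoints A) :
    𝟙 X = (cylIso (Equiv.refl X.pos) (Equiv.refl X.neg)).hom := rfl

theorem cylIso_congr {X Y : OrientedPoints A} {p p' : X.pos ≃ Y.pos} {n n' : X.neg ≃ Y.neg}
    (hp : ∀ x, p x = p' x) (hn : ∀ x, n x = n' x) : (cylIso p n).hom = (cylIso p' n').hom := by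
  rw [Equiv.ext hp, Equiv.ext hn]

instance : MonoidalCategory (OrientedPoints A) := MonoidalCategory.ofTensorHom
  (id_tensorHom_id := fun X Y => by
    rw [id_eq_cylIso, id_eq_cylIso, tensor_cylIso]
    exact cylIso_congr (by rintro (_ | _) <;> rfl) (by rintro (_ | _) <;> rfl))
  (id_tensorHom := fun _ _ _ _ => rfl)
  (tensorHom_id := fun _ _ => rfl)
  (tensorHom_comp_tensorHom := fun f g h k => Cobordism.tensor_comp f g h k)
  (associator_naturality := fun f g h => by
    change Cobordism.comp (Cobordism.tensor (Cobordism.tensor f g) h) (Cobordism.cyl _ _) =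
      Cobordism.comp (Cobordism.cyl _ _) (Cobordism.tensor f (Cobordism.tensor g h))
    rw [Cobordism.comp_cyl, Cobordism.cyl_comp]
    unfold Cobordism.tensor
    rw [Cobordism.disj_relabel_left, Cobordism.disj_relabel_right, Cobordism.disj_assoc]
    simp only [Cobordism.relabel_relabel]
    refine Cobordism.relabel_congr ?_ ?_ _ <;> rintro (((_ | _) | (_ | _)) | (_ | _)) <;> rfl)
  (leftUnitor_naturality := fun f => by
    change Cobordism.comp (Cobordism.tensor (Cobordism.cyl _ _) f) (Cobordism.cyl _ _) =
      Cobordism.comp (Cobordism.cyl _ _) f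
    rw [Cobordism.comp_cyl, Cobordism.cyl_comp]
    unfold Cobordism.tensor Cobordism.cyl
    rw [Cobordism.disj_comm f, Cobordism.disj_arcs_empty]
    simp only [Cobordism.relabel_relabel]
    refine Cobordism.relabel_congr ?_ ?_ _ <;> rintro (_ | _) <;> rfl)
  (rightUnitor_naturality := fun f => by
    change Cobordism.comp (Cobordism.tensor f (Cobordism.cyl _ _)) (Cobordism.cyl _ _) =
      Cobordism.comp (Cobordism.cyl _ _) f
    rw [Cobordism.comp_cyl, Cobordism.cyl_comp]
    unfold Cobordism.tensor Cobordism.cyl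
    rw [Cobordism.disj_arcs_empty]
    simp only [Cobordism.relabel_relabel]
    refine Cobordism.relabel_congr ?_ ?_ _ <;> rintro (_ | _) <;> rfl)
  (pentagon := fun W X Y Z => by
    change ((cylIso _ _).hom ⊗ₘ (cylIso _ _).hom) ≫ (cylIso _ _).hom ≫
      ((cylIso _ _).hom ⊗ₘ (cylIso _ _).hom) = (cylIso _ _).hom ≫ (cylIso _ _).hom
    rw [tensor_cylIso, tensor_cylIso, cyl_comp_cyl, cyl_comp_cyl,
      cyl_comp_cyl]
    exact cylIso_congr (by rintro (((_ | _) | _) | _) <;> rfl)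
      (by rintro (((_ | _) | _) | _) <;> rfl))
  (triangle := fun X Y => by
    change (cylIso _ _).hom ≫ ((cylIso _ _).hom ⊗ₘ (cylIso _ _).hom) =
      (cylIso _ _).hom ⊗ₘ (cylIso _ _).hom
    rw [tensor_cylIso, tensor_cylIso, cyl_comp_cyl]
    exact cylIso_congr (by rintro ((_ | _) | _) <;> first | rfl | contradiction)
      (by rintro ((_ | _) | _) <;> first | rfl | contradiction))

instance : SymmetricCategory (OrientedPoints A) where
  braiding X Y := cylIso (Equiv.sumComm X.pos Y.pos) (Equiv.sumComm X.neg Y.neg)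
  braiding_naturality_right X {Y Z} f := by
    change Cobordism.comp (Cobordism.tensor (Cobordism.cyl _ _) f) (Cobordism.cyl _ _) =
      Cobordism.comp (Cobordism.cyl _ _) (Cobordism.tensor f (Cobordism.cyl _ _))
    rw [Cobordism.comp_cyl, Cobordism.cyl_comp]
    unfold Cobordism.tensor
    rw [Cobordism.disj_comm f]
    simp only [Cobordism.relabel_relabel]
    refine Cobordism.relabel_congr ?_ ?_ _ <;> rintro ((_ | _) | (_ | _)) <;> rfl
  braiding_naturality_left {X Y} f Z := by
    change Cobordism.comp (Cobordism.tensor f (Cobordism.cyl _ _)) (Cobordism.cyl _ _) =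
      Cobordism.comp (Cobordism.cyl _ _) (Cobordism.tensor (Cobordism.cyl _ _) f)
    rw [Cobordism.comp_cyl, Cobordism.cyl_comp]
    unfold Cobordism.tensor
    rw [Cobordism.disj_comm f]
    simp only [Cobordism.relabel_relabel]
    refine Cobordism.relabel_congr ?_ ?_ _ <;> rintro ((_ | _) | (_ | _)) <;> rfl
  hexagon_forward X Y Z := by
    change (cylIso _ _).hom ≫ (cylIso _ _).hom ≫ (cylIso _ _).hom =
      ((cylIso _ _).hom ⊗ₘ (cylIso _ _).hom) ≫ (cylIso _ _).hom ≫
        ((cylIso _ _).hom ⊗ₘ (cylIso _ _).hom)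
    rw [tensor_cylIso, tensor_cylIso, cyl_comp_cyl, cyl_comp_cyl, cyl_comp_cyl, cyl_comp_cyl]
    exact cylIso_congr (by rintro ((_ | _) | _) <;> rfl) (by rintro ((_ | _) | _) <;> rfl)
  hexagon_reverse X Y Z := by
    change (cylIso _ _).hom ≫ (cylIso _ _).hom ≫ (cylIso _ _).hom =
      ((cylIso _ _).hom ⊗ₘ (cylIso _ _).hom) ≫ (cylIso _ _).hom ≫
        ((cylIso _ _).hom ⊗ₘ (cylIso _ _).hom)
    rw [tensor_cylIso, tensor_cylIso, cyl_comp_cyl, cyl_comp_cyl, cyl_comp_cyl, cyl_comp_cyl]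
    exact cylIso_congr (by rintro (_ | (_ | _)) <;> rfl) (by rintro (_ | (_ | _)) <;> rfl)
  symmetry X Y := by
    change (cylIso _ _).hom ≫ (cylIso _ _).hom = (cylIso _ _).hom
    rw [cyl_comp_cyl]
    exact cylIso_congr (by rintro (_ | _) <;> rfl) (by rintro (_ | _) <;> rfl)

end OrientedPoints
/-- Signs (orientations of points). -/
inductive Sgn
  | plus
  | minus
  deriving DecidableEq

/-- The points with sign `s` in a sign sequence. -/
abbrev Points (s : Sgn) (l : List Sgn) : Type := {i : Fin l.length // l.get i = s}

def pointsAppend (s : Sgn) (l l' : List Sgn) : Points s (l ++ l') ≃ Points s l ⊕ Points s l' :=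
  ((finSumFinEquiv.trans (finCongr List.length_append.symm)).subtypeEquiv
    (p := fun c => Sum.elim (fun i => l.get i = s) (fun i => l'.get i = s) c)
    (by rintro (i | i) <;> simp)).symm.trans Equiv.subtypeSum

/-- The category `Cob^h_Σ` for the alphabet `Σ = A`. Its objects are finite sequences of signs; the
morphisms are the equivalence classes of decorated cobordisms between the corresponding oriented
`0`-manifolds. -/
structure CobH (A : Type) where
  signs : List Sgn

namespace CobH

variable {A : Type}

/-- The oriented `0`-manifold of a sign sequence. -/
def points (X : CobH A) : OrientedPoints A := ⟨Points .plus X.signs, Points .minus X.signs⟩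

instance : Category (CobH A) where
  Hom X Y := X.points ⟶ Y.points
  id X := 𝟙 X.points
  comp {X _ Z} f g := (f ≫ g : X.points ⟶ Z.points)
  id_comp f := Category.id_comp (obj := OrientedPoints A) f
  comp_id f := Category.comp_id (obj := OrientedPoints A) f
  assoc f g h := Category.assoc (obj := OrientedPoints A) f g h

/-- The fully faithful functor along which the symmetric monoidal structure is induced. -/
def toPoints (A : Type) : CobH A ⥤ OrientedPoints A where
  obj := points
  map f := f

instance : (toPoints A).Faithful where
  map_injective h := h

instance : (toPoints A).Full where
  map_surjective f := ⟨f, rfl⟩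

def homOfPoints {X Y : CobH A} (f : X.points ⟶ Y.points) : X ⟶ Y := f

def isoOfPoints {X Y : CobH A} (e : X.points ≅ Y.points) : X ≅ Y where
  hom := e.hom
  inv := e.inv
  hom_inv_id := e.hom_inv_id
  inv_hom_id := e.inv_hom_id

/-- Concatenation of sequences corresponds to disjoint union of oriented `0`-manifolds. -/
def appendIso (X Y : CobH A) : X.points ⊗ Y.points ≅ points (A := A) ⟨X.signs ++ Y.signs⟩ :=
  OrientedPoints.cylIso (pointsAppend .plus X.signs Y.signs).symm
    (pointsAppend .minus X.signs Y.signs).symm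

instance (s : Sgn) : IsEmpty (Points s []) := ⟨fun i => i.1.elim0⟩

def nilIso : 𝟙_ (OrientedPoints A) ≅ points (A := A) ⟨[]⟩ :=
  OrientedPoints.cylIso (Equiv.equivOfIsEmpty Empty (Points .plus []))
    (Equiv.equivOfIsEmpty Empty (Points .minus []))

/-- The tensor product is concatenation of sequences and disjoint union of cobordisms. -/
instance : MonoidalCategoryStruct (CobH A) where
  tensorObj X Y := ⟨X.signs ++ Y.signs⟩
  tensorUnit := ⟨[]⟩
  tensorHom {X₁ Y₁ X₂ Y₂} f g := homOfPoints ((appendIso X₁ X₂).inv ≫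
    ((toPoints A).map f ⊗ₘ (toPoints A).map g) ≫ (appendIso Y₁ Y₂).hom)
  whiskerLeft X Y Z f := homOfPoints ((appendIso X Y).inv ≫ (X.points ◁ (toPoints A).map f) ≫
    (appendIso X Z).hom)
  whiskerRight {X Y} f Z := homOfPoints ((appendIso X Z).inv ≫ ((toPoints A).map f ▷ Z.points) ≫
    (appendIso Y Z).hom)
  associator X Y Z := isoOfPoints
    (((appendIso ⟨X.signs ++ Y.signs⟩ Z).symm ≪≫
      ((appendIso X Y).symm ⊗ᵢ Iso.refl Z.points)) ≪≫
      (α_ X.points Y.points Z.points ≪≫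
      ((Iso.refl X.points ⊗ᵢ appendIso Y Z) ≪≫ appendIso X ⟨Y.signs ++ Z.signs⟩)))
  leftUnitor X := isoOfPoints (((appendIso ⟨[]⟩ X).symm ≪≫ (nilIso.symm ⊗ᵢ Iso.refl X.points)) ≪≫
    λ_ X.points)
  rightUnitor X := isoOfPoints (((appendIso X ⟨[]⟩).symm ≪≫ (Iso.refl X.points ⊗ᵢ nilIso.symm)) ≪≫
    ρ_ X.points)

def inducingData (A : Type) : Monoidal.InducingFunctorData (toPoints A) where
  μIso X Y := appendIso X Y
  εIso := nilIso
  whiskerLeft_eq _ _ _ _ := rfl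
  whiskerRight_eq _ _ := rfl
  tensorHom_eq _ _ := rfl
  associator_eq X Y Z := by
    rfl
  leftUnitor_eq _ := rfl
  rightUnitor_eq _ := rfl

instance : MonoidalCategory (CobH A) := Monoidal.induced (toPoints A) (inducingData A)

instance : (toPoints A).Monoidal := Monoidal.fromInducedMonoidal (toPoints A) (inducingData A)

instance : BraidedCategory (CobH A) := .ofFaithful (toPoints A)
  (fun X Y => isoOfPoints ((appendIso X Y).symm ≪≫ β_ X.points Y.points ≪≫ appendIso Y X))
  (fun X Y => by
    change (appendIso X Y).hom ≫ (appendIso X Y).inv ≫ (β_ X.points Y.points).hom ≫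
      (appendIso Y X).hom = (β_ X.points Y.points).hom ≫ (appendIso Y X).hom
    rw [Iso.hom_inv_id_assoc])

instance : (toPoints A).Braided where
  braided X Y := by
    change (appendIso X Y).hom ≫ (appendIso X Y).inv ≫ (β_ X.points Y.points).hom ≫
      (appendIso Y X).hom = (β_ X.points Y.points).hom ≫ (appendIso Y X).hom
    rw [Iso.hom_inv_id_assoc]

instance : SymmetricCategory (CobH A) := .ofFaithful (toPoints A)

end CobH

/-- The Boolean semiring `{0, 1 | 1 + 1 = 1}`. -/
inductive 𝔹
  | zero
  | one

namespace 𝔹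

def add : 𝔹 → 𝔹 → 𝔹
  | zero, x => x
  | one, _ => one

def mul : 𝔹 → 𝔹 → 𝔹
  | zero, _ => zero
  | one, x => x

instance : Zero 𝔹 := ⟨zero⟩

instance : One 𝔹 := ⟨one⟩

instance : Add 𝔹 := ⟨add⟩

instance : Mul 𝔹 := ⟨mul⟩

instance : CommSemiring 𝔹 where
  add_assoc := by rintro (_ | _) (_ | _) (_ | _) <;> rfl
  zero_add := by rintro (_ | _) <;> rfl
  add_zero := by rintro (_ | _) <;> rfl
  add_comm := by rintro (_ | _) (_ | _) <;> rfl
  left_distrib := by rintro (_ | _) (_ | _) (_ | _) <;> rfl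
  right_distrib := by rintro (_ | _) (_ | _) (_ | _) <;> rfl
  zero_mul := by rintro (_ | _) <;> rfl
  mul_zero := by rintro (_ | _) <;> rfl
  mul_assoc := by rintro (_ | _) (_ | _) (_ | _) <;> rfl
  one_mul := by rintro (_ | _) <;> rfl
  mul_one := by rintro (_ | _) <;> rfl
  mul_comm := by rintro (_ | _) (_ | _) <;> rfl
  nsmul := nsmulRec
  npow := npowRec

theorem one_add_one : (1 : 𝔹) + 1 = 1 := rfl

end 𝔹

/-- Free `𝔹`-semimodules. -/
def isFree : ObjectProperty (SemimoduleCat.{0} 𝔹) := fun M => Module.Free 𝔹 M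

instance : isFree.IsMonoidal where
  prop_unit := inferInstanceAs (Module.Free 𝔹 𝔹)
  prop_tensor M N hM hN := by
    have : Module.Free 𝔹 M := hM
    have : Module.Free 𝔹 N := hN
    exact inferInstanceAs (Module.Free 𝔹 (TensorProduct 𝔹 M N))

/-- The symmetric monoidal category `𝔹-fmod` of free `𝔹`-semimodules, with the tensor product
over `𝔹`. -/
abbrev FreeBMod := isFree.FullSubcategory


/-- A Boolean TQFT: a symmetric (strong) monoidal functor from `Cob^h_Σ` to free
`𝔹`-semimodules. -/
structure BooleanTQFT (A : Type) where
  functor : CobH A ⥤ FreeBMod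
  [braided : functor.Braided]

attribute [instance] BooleanTQFT.braided

namespace BooleanTQFT

open scoped TensorProduct

variable {A : Type} (F : BooleanTQFT A)

/-- The state space `F(X)`. -/
abbrev space (X : CobH A) : SemimoduleCat.{0} 𝔹 := (F.functor.obj X).obj

/-- The linear map `F(f) : F(X) → F(Y)`. -/
def lin {X Y : CobH A} (f : X ⟶ Y) : F.space X →ₗ[𝔹] F.space Y := (F.functor.map f).hom.hom

/-- The structure map `F(X) ⊗ F(Y) → F(X ⊗ Y)` (an isomorphism). -/
def mul (X Y : CobH A) : F.space X ⊗[𝔹] F.space Y →ₗ[𝔹] F.space (X ⊗ Y) :=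
  (Functor.LaxMonoidal.μ F.functor X Y).hom.hom

/-- The structure map `𝔹 → F(∅)` (an isomorphism). -/
def unit : 𝔹 →ₗ[𝔹] F.space (𝟙_ (CobH A)) := (Functor.LaxMonoidal.ε F.functor).hom.hom

/-- The structure map `F(∅) → 𝔹`, inverse to `unit`. -/
def counit : F.space (𝟙_ (CobH A)) →ₗ[𝔹] 𝔹 := (Functor.OplaxMonoidal.η F.functor).hom.hom

/-- The vector in `F(X)` given by a cobordism from the empty sequence to `X`. -/
def vec {X : CobH A} (f : 𝟙_ (CobH A) ⟶ X) : F.space X := F.lin f (F.unit 1)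

/-- The functional on `F(X)` given by a cobordism from `X` to the empty sequence. -/
def form {X : CobH A} (f : X ⟶ 𝟙_ (CobH A)) : F.space X →ₗ[𝔹] 𝔹 := F.counit ∘ₗ F.lin f

/-- The evaluation in `𝔹` of a closed cobordism. -/
def eval (f : 𝟙_ (CobH A) ⟶ 𝟙_ (CobH A)) : 𝔹 := F.form f (F.unit 1)

end BooleanTQFT

namespace CobH

variable {A : Type}

def plus : CobH A := ⟨[.plus]⟩

def minus : CobH A := ⟨[.minus]⟩

/-- The cobordism glued from the segments of a diagram. -/
def ofDiagram {X Y : CobH A} {J O : Type} [Finite J] [Finite O]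
    (D : Diagram A (Points .plus X.signs ⊕ Points .minus Y.signs)
      (Points .minus X.signs ⊕ Points .plus Y.signs) J O) : X ⟶ Y :=
  Cobordism.mk D


instance : IsEmpty (Points .minus [.plus]) := ⟨by decide⟩

instance : IsEmpty (Points .plus [.minus]) := ⟨by decide⟩

instance : Unique (Points .plus [.plus]) :=
  ⟨⟨⟨0, rfl⟩⟩, by decide⟩

instance : Unique (Points .minus [.minus]) :=
  ⟨⟨⟨0, rfl⟩⟩, by decide⟩

instance : Unique (Points .plus [.plus, .minus]) :=
  ⟨⟨⟨0, rfl⟩⟩, by decide⟩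

instance : Unique (Points .minus [.plus, .minus]) :=
  ⟨⟨⟨1, rfl⟩⟩, by decide⟩

instance : Unique (Points .plus [.minus, .plus]) :=
  ⟨⟨⟨1, rfl⟩⟩, by decide⟩

instance : Unique (Points .minus [.minus, .plus]) :=
  ⟨⟨⟨0, rfl⟩⟩, by decide⟩

/-- A vertical strand of sign `s` carrying the word `w`, read along the orientation of the strand
(upward for `+`, downward for `-`). -/
def strand (s : Sgn) (w : List A) : (⟨[s]⟩ : CobH A) ⟶ ⟨[s]⟩ :=
  ofDiagram (Diagram.arcs (Equiv.sumComm _ _) (fun _ => w))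

/-- The cup from the empty sequence to `+-`, without defects. -/
def cup : 𝟙_ (CobH A) ⟶ plus ⊗ minus :=
  ofDiagram (X := ⟨[]⟩) (Y := ⟨[.plus, .minus]⟩)
    (Diagram.arcs ((Equiv.emptySum _ _).trans ((Equiv.ofUnique _ _).trans
      (Equiv.emptySum _ _).symm)) (fun _ => []))

/-- The cap from `+-` to the empty sequence, without defects. -/
def cap : (plus ⊗ minus : CobH A) ⟶ 𝟙_ (CobH A) :=
  ofDiagram (X := ⟨[.plus, .minus]⟩) (Y := ⟨[]⟩)
    (Diagram.arcs ((Equiv.sumEmpty _ _).trans ((Equiv.ofUnique _ _).trans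
      (Equiv.sumEmpty _ _).symm)) (fun _ => []))

/-- The cap from `-+` to the empty sequence, without defects. -/
def cap' : (minus ⊗ plus : CobH A) ⟶ 𝟙_ (CobH A) :=
  ofDiagram (X := ⟨[.minus, .plus]⟩) (Y := ⟨[]⟩)
    (Diagram.arcs ((Equiv.sumEmpty _ _).trans ((Equiv.ofUnique _ _).trans
      (Equiv.sumEmpty _ _).symm)) (fun _ => []))

/-- The half-interval from an in-oriented inner endpoint to a top point `+`, with the finite
word `w`. -/
def inHalf (w : List A) : 𝟙_ (CobH A) ⟶ plus :=
  ofDiagram (X := ⟨[]⟩) (Y := ⟨[.plus]⟩) (J := Empty) (O := Empty)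
    { next := isEmptyElim
      next_injective := fun a => isEmptyElim a
      word := fun _ => w
      ray := Empty.elim }

/-- The half-interval from a bottom point `+` to an out-oriented inner endpoint, with the
right-infinite word `ω`. -/
def outHalf (ω : Stream' A) : plus ⟶ 𝟙_ (CobH A) :=
  ofDiagram (X := ⟨[.plus]⟩) (Y := ⟨[]⟩) (J := Empty) (O := Unit)
    { next := fun _ => Sum.inr ()
      next_injective := by
        rintro ((a | a) | a) ((b | b) | b) _ <;>
          first | exact isEmptyElim a | exact isEmptyElim b | rw [Subsingleton.elim a b]
      word := isEmptyElim
      ray := fun _ => ω }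

/-- The half-interval from a top point `-` to an out-oriented inner endpoint, with the
right-infinite word `ω`. -/
def outHalf' (ω : Stream' A) : 𝟙_ (CobH A) ⟶ minus :=
  ofDiagram (X := ⟨[]⟩) (Y := ⟨[.minus]⟩) (J := Empty) (O := Unit)
    { next := fun _ => Sum.inr ()
      next_injective := by
        rintro ((a | a) | a) ((b | b) | b) _ <;>
          first | exact isEmptyElim a | exact isEmptyElim b | rw [Subsingleton.elim a b]
      word := isEmptyElim
      ray := fun _ => ω }

/-- The floating interval with the right-infinite word `ω`. -/
def floatingInterval (ω : Stream' A) : 𝟙_ (CobH A) ⟶ 𝟙_ (CobH A) :=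
  ofDiagram (X := ⟨[]⟩) (Y := ⟨[]⟩) (J := Empty) (O := Unit)
    { next := isEmptyElim
      next_injective := fun a => isEmptyElim a
      word := isEmptyElim
      ray := fun _ => ω }

/-- The floating circle with the finite (circular) word `w`. -/
def circle (w : List A) : 𝟙_ (CobH A) ⟶ 𝟙_ (CobH A) :=
  ofDiagram (X := ⟨[]⟩) (Y := ⟨[]⟩) (J := Unit) (O := Empty)
    { next := fun _ => Sum.inl (Sum.inr ())
      next_injective := by
        rintro ((a | a) | a) ((b | b) | b) _ <;>
          first | exact isEmptyElim a | exact isEmptyElim b | rfl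
      word := fun _ => w
      ray := Empty.elim }

end CobH

/-- A (nondeterministic) Muller automaton with alphabet `A` and set of states `Q`: transition
function, set of initial states, and the family of subsets of `Q` that defines acceptance. -/
structure MullerAutomaton (A Q : Type) where
  trans : Q → A → Set Q
  init : Set Q
  acc : Set (Set Q)

namespace MullerAutomaton

variable {A Q : Type} (M : MullerAutomaton A Q)

/-- `ρ` is an infinite path starting at `q` and spelling `ω`. -/
def IsPath (q : Q) (ω : Stream' A) (ρ : ℕ → Q) : Prop :=
  ρ 0 = q ∧ ∀ i, ρ (i + 1) ∈ M.trans (ρ i) (ω.get i)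

/-- The set of states which appear in `ρ` infinitely many times. -/
def inf (ρ : ℕ → Q) : Set Q := {q | ∃ᶠ i in Filter.atTop, ρ i = q}

/-- There is a path starting at `q` and spelling `ω` whose set of states visited infinitely often
belongs to the acceptance family. -/
def AcceptsFrom (q : Q) (ω : Stream' A) : Prop := ∃ ρ, M.IsPath q ω ρ ∧ inf ρ ∈ M.acc

/-- Muller acceptance of a right-infinite word. -/
def Accepts (ω : Stream' A) : Prop := ∃ q ∈ M.init, M.AcceptsFrom q ω

/-- There is a path from `q` to `q'` spelling the finite word `w`. -/
def Reaches (q : Q) : List A → Q → Prop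
  | [], q' => q = q'
  | a :: w, q' => ∃ r ∈ M.trans q a, Reaches r w q'

end MullerAutomaton

end MullerTQFT

open MullerTQFT MullerTQFT.CobH
open scoped TensorProduct

/-! The TQFT is a Boolean state sum. To a `0`-manifold it assigns the free semimodule on all
assignments of states of the automaton to its points. To a cobordism it assigns the `0`-`1` matrix
whose entry at a pair of boundary assignments records whether the automaton can run along the whole
`1`-manifold with these boundary states: every segment must be readable from the state at its start
to the state at its end, a start at an inner endpoint allows any initial state, and an end at an
inner endpoint requires Muller acceptance.

A Boolean matrix is a relation. As sums in `𝔹` are disjunctions (`𝔹.sum_eq_one`), the matrix product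
is composition of relations, and identities of linear maps become equivalences of propositions. A
run along a glued manifold is a run along the unglued one whose states agree at the glued points
(`runs_glue`), and a run along a disjoint union is a pair of runs (`runs_disj`). The first fact
gives, together with the second, functoriality; the second gives compatibility with tensor products,
because the free semimodule on a product of sets is the tensor product. Finiteness of the state set
ensures that the rows of the matrices are finitely supported.

The matrix must depend only on the homeomorphism class, that is, it must not change when a segment
is cut (`runs_iff_of_isSubdivision`). For finite words this holds because a path spelling a
concatenation passes through an intermediate state (`reaches_append`). For right-infinite words it
also needs that acceptance ignores finite prefixes (`acceptsFrom_append`), and this rests on the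
fact that `inf` is invariant under shifts (`inf_tail`). The Muller condition enters in no other way.

Boundary states are recorded at sources and targets of oriented segments, so a negative point
differs from a positive one only in the direction of reading. Hence the dual action on `F(-)` needs
no separate construction. The prescribed values follow by unfolding what a run is on diagrams with a
single segment. -/

namespace MullerTQFT

/-! ### Paths and concatenation of words -/

namespace MullerAutomaton

variable {A Q : Type} (M : MullerAutomaton A Q)

/-- The intermediate state `r` is the one that a run places on a junction cutting the word into `u`
and `w`. -/
theorem reaches_append (q : Q) (u w : List A) (q' : Q) :
    M.Reaches q (u ++ w) q' ↔ ∃ r, M.Reaches q u r ∧ M.Reaches r w q' := by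
  induction u generalizing q with
  | nil => simp [Reaches]
  | cons a u ih =>
    simp only [List.cons_append, Reaches, ih]
    constructor
    · rintro ⟨s, hs, r, h, h'⟩
      exact ⟨r, ⟨s, hs, h⟩, h'⟩
    · rintro ⟨r, ⟨s, hs, h⟩, h'⟩
      exact ⟨s, hs, r, h, h'⟩

/-- Dropping one term only shifts the bound beyond which a state no longer occurs. This is the one
property of the Muller condition that the construction uses. -/
theorem inf_tail (ρ : ℕ → Q) : inf (fun i => ρ (i + 1)) = inf ρ := by
  ext q
  simp only [inf, Set.mem_ofPred_eq, Filter.Frequently, Filter.eventually_atTop]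
  refine not_congr ⟨?_, ?_⟩
  · rintro ⟨N, h⟩
    refine ⟨N + 1, fun i hi => ?_⟩
    obtain ⟨i, rfl⟩ : ∃ k, i = k + 1 := ⟨i - 1, by omega⟩
    exact h i (by omega)
  · rintro ⟨N, h⟩
    exact ⟨N, fun i hi => h (i + 1) (by omega)⟩

theorem acceptsFrom_cons (q : Q) (a : A) (ω : Stream' A) :
    M.AcceptsFrom q (Stream'.cons a ω) ↔ ∃ r ∈ M.trans q a, M.AcceptsFrom r ω := by
  constructor
  · rintro ⟨ρ, ⟨h0, h⟩, hρ⟩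
    refine ⟨ρ 1, ?_, fun i => ρ (i + 1), ⟨rfl, fun i => h (i + 1)⟩, ?_⟩
    · rw [← h0]
      exact h 0
    · rwa [inf_tail]
  · rintro ⟨r, hr, ρ, ⟨rfl, h⟩, hρ⟩
    refine ⟨fun | 0 => q | i + 1 => ρ i, ⟨rfl, ?_⟩, ?_⟩
    · rintro (_ | i)
      · exact hr
      · exact h i
    · rwa [← inf_tail]

/-- A finite prefix only selects the state from which the remaining word is read, since acceptance
depends on the tail of a path. This permits cutting a segment that ends at an inner endpoint. -/
theorem acceptsFrom_append (q : Q) (u : List A) (ω : Stream' A) :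
    M.AcceptsFrom q (u ++ₛ ω) ↔ ∃ r, M.Reaches q u r ∧ M.AcceptsFrom r ω := by
  induction u generalizing q with
  | nil => simp [Reaches]
  | cons a u ih =>
    rw [Stream'.cons_append_stream, acceptsFrom_cons]
    simp only [Reaches, ih]
    constructor
    · rintro ⟨s, hs, r, h, h'⟩
      exact ⟨r, ⟨s, hs, h⟩, h'⟩
    · rintro ⟨r, ⟨s, hs, h⟩, h'⟩
      exact ⟨s, hs, r, h, h'⟩

/-! ### Runs along a diagram -/

variable {S T S' T' J O J' O' K N : Type}

/-- The state `q` is possible at the start of the segment `e`: it is the state `v a` if the segment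
starts at the point `a`, and an initial state if it starts at an inner endpoint. -/
def StartsAt (P : Diagram A S T J O) (v : S ⊕ J → Q) (e : (T ⊕ J) ⊕ O) (q : Q) : Prop :=
  (∃ a, P.next a = e ∧ q = v a) ∨ ((∀ a, P.next a ≠ e) ∧ q ∈ M.init)

/-- The automaton can read the label of a segment from the state `q`, ending in the state `v x` if
the segment ends at the point `x`, and accepting if it ends at an inner endpoint. -/
def EndsAt (v : T ⊕ J → Q) : (T ⊕ J) ⊕ O → List A ⊕ Stream' A → Q → Prop
  | .inl x, .inl w, q => M.Reaches q w (v x)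
  | .inr _, .inr ω, q => M.AcceptsFrom q ω
  | _, _, _ => False

/-- The automaton can run along the diagram with the states `σ` at the sources and `τ` at the
targets. -/
def Runs (P : Diagram A S T J O) (σ : S → Q) (τ : T → Q) : Prop :=
  ∃ j : J → Q, ∀ e, ∃ q, M.StartsAt P (Sum.elim σ j) e q ∧ M.EndsAt (Sum.elim τ j) e (P.label e) q

/-- By injectivity of `next`, a segment has at most one starting point; if it has one, the
alternative of an initial state is excluded. -/
theorem startsAt_next (P : Diagram A S T J O) (v : S ⊕ J → Q) (a : S ⊕ J) (q : Q) :
    M.StartsAt P v (P.next a) q ↔ q = v a := by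
  constructor
  · rintro (⟨b, h, rfl⟩ | ⟨h, -⟩)
    · rw [P.next_injective h]
    · exact absurd rfl (h a)
  · rintro rfl
    exact .inl ⟨a, rfl, rfl⟩

/-- Once `φ` matches the starting points of the two segments, one starts at an inner endpoint
exactly when the other does. The map `φ` need not be surjective, because a subdivision or a disjoint
union has points outside its image. -/
theorem startsAt_congr {P : Diagram A S T J O} {R : Diagram A S' T' J' O'} (φ : S ⊕ J → S' ⊕ J')
    {e : (T ⊕ J) ⊕ O} {e' : (T' ⊕ J') ⊕ O'} (h : ∀ a, P.next a = e → R.next (φ a) = e')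
    (h' : ∀ b, R.next b = e' → ∃ a, φ a = b ∧ P.next a = e) (v : S' ⊕ J' → Q) (q : Q) :
    M.StartsAt R v e' q ↔ M.StartsAt P (v ∘ φ) e q := by
  constructor
  · rintro (⟨b, hb, rfl⟩ | ⟨hb, hq⟩)
    · obtain ⟨a, rfl, ha⟩ := h' b hb
      exact .inl ⟨a, ha, rfl⟩
    · exact .inr ⟨fun a ha => hb _ (h a ha), hq⟩
  · rintro (⟨a, ha, rfl⟩ | ⟨ha, hq⟩)
    · exact .inl ⟨_, h a ha, rfl⟩
    · refine .inr ⟨fun b hb => ?_, hq⟩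
      obtain ⟨a, -, h2⟩ := h' b hb
      exact ha a h2

/-- Treats finite and right-infinite labels at once; if the kind of label does not fit the kind of
end, both sides are false. -/
theorem endsAt_prefix (v : T ⊕ J → Q) (e : (T ⊕ J) ⊕ O) (u : List A) (l : List A ⊕ Stream' A)
    (q : Q) : M.EndsAt v e (Diagram.prefixLabel u l) q ↔
      ∃ r, M.Reaches q u r ∧ M.EndsAt v e l r := by
  rcases e with e | e <;> rcases l with l | l <;>
    simp [EndsAt, Diagram.prefixLabel, reaches_append, acceptsFrom_append]

theorem endsAt_map (v : T' ⊕ J' → Q) (f : T ⊕ J → T' ⊕ J') (g : O → O') (e : (T ⊕ J) ⊕ O)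
    (l : List A ⊕ Stream' A) (q : Q) :
    M.EndsAt v (Sum.map f g e) l q ↔ M.EndsAt (v ∘ f) e l q := by
  rcases e with e | e <;> rcases l with l | l <;> simp [EndsAt]

/-! ### Invariance of runs under subdivision -/

section subdivision

variable {P : Diagram A S T J O} {R : Diagram A S T J' O'} {eJ : J ⊕ K ≃ J'} {eO : O ≃ O'}
  {cut : K → (T ⊕ J) ⊕ O}

theorem map_subdivision_injective (eJ : J ⊕ K ≃ J') (eO : O ≃ O') : Function.Injective
    (Sum.map (Sum.map id (eJ ∘ Sum.inl)) eO : (T ⊕ J) ⊕ O → (T ⊕ J') ⊕ O') :=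
  (Function.injective_id.sumMap (eJ.injective.comp Sum.inl_injective)).sumMap eO.injective

theorem exists_old_or_new (eJ : J ⊕ K ≃ J') (b : S ⊕ J') :
    (∃ a : S ⊕ J, b = Sum.map id (eJ ∘ Sum.inl) a) ∨ ∃ k, b = Sum.inr (eJ (Sum.inr k)) := by
  rcases b with s | j
  · exact .inl ⟨.inl s, rfl⟩
  · obtain ⟨j | k, rfl⟩ := eJ.surjective j
    · exact .inl ⟨.inr j, rfl⟩
    · exact .inr ⟨k, rfl⟩

theorem map_subdivision_ne_new (e : (T ⊕ J) ⊕ O) (k : K) :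
    Sum.map (Sum.map id (eJ ∘ Sum.inl)) eO e ≠ .inl (.inr (eJ (.inr k))) := by
  rcases e with (e | e) | e <;> simp

/-- The initial part of a cut segment inherits its start. Conversely, only the segment from an old
point can end at a new junction, and only if that segment was cut there. -/
theorem startsAt_new (h : P.IsSubdivision R eJ eO cut) (v : S ⊕ J' → Q) (k : K) (q : Q) :
    M.StartsAt R v (.inl (.inr (eJ (.inr k)))) q ↔
      M.StartsAt P (v ∘ Sum.map id (eJ ∘ Sum.inl)) (cut k) q := by
  refine M.startsAt_congr _ (fun a ha => h.next_cut a k ha) (fun b hb => ?_) v q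
  obtain ⟨a, rfl⟩ | ⟨k', rfl⟩ := exists_old_or_new eJ b
  · refine ⟨a, rfl, ?_⟩
    by_cases ha : ∃ k', P.next a = cut k'
    · obtain ⟨k', hk'⟩ := ha
      rw [h.next_cut a k' hk'] at hb
      simp only [Sum.inl.injEq, Sum.inr.injEq, EmbeddingLike.apply_eq_iff_eq] at hb
      rw [hk', hb]
    · rw [h.next_old a (not_exists.1 ha)] at hb
      exact absurd hb (map_subdivision_ne_new _ _)
  · rw [h.next_new] at hb
    exact absurd hb (map_subdivision_ne_new _ _)

/-- A new junction is the start only of the final part of a cut segment, so an uncut segment keeps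
its start. -/
theorem startsAt_old (h : P.IsSubdivision R eJ eO cut) (v : S ⊕ J' → Q) (e : (T ⊕ J) ⊕ O)
    (he : ∀ k, e ≠ cut k) (q : Q) :
    M.StartsAt R v (Sum.map (Sum.map id (eJ ∘ Sum.inl)) eO e) q ↔
      M.StartsAt P (v ∘ Sum.map id (eJ ∘ Sum.inl)) e q := by
  refine M.startsAt_congr _ (fun a ha => ?_) (fun b hb => ?_) v q
  · rw [h.next_old a (fun k => ha ▸ he k), ha]
  · obtain ⟨a, rfl⟩ | ⟨k', rfl⟩ := exists_old_or_new eJ b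
    · refine ⟨a, rfl, ?_⟩
      by_cases ha : ∃ k', P.next a = cut k'
      · obtain ⟨k', hk'⟩ := ha
        rw [h.next_cut a k' hk'] at hb
        exact absurd hb.symm (map_subdivision_ne_new _ _)
      · rw [h.next_old a (not_exists.1 ha)] at hb
        exact map_subdivision_injective eJ eO hb
    · rw [h.next_new] at hb
      exact absurd (map_subdivision_injective eJ eO hb).symm (he k')

theorem startsAt_cut (h : P.IsSubdivision R eJ eO cut) (v : S ⊕ J' → Q) (k : K) (q : Q) :
    M.StartsAt R v (Sum.map (Sum.map id (eJ ∘ Sum.inl)) eO (cut k)) q ↔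
      q = v (.inr (eJ (.inr k))) := by
  rw [← h.next_new, startsAt_next]

theorem elim_comp_map_id (σ : S → Q) (j : J' → Q) (f : J → J') :
    Sum.elim σ j ∘ Sum.map id f = Sum.elim σ (j ∘ f) := by
  rw [Sum.elim_comp_map, Function.comp_id]

/-- Homeomorphism invariance. Uncut segments impose the same condition in both diagrams. For a cut
segment, reading the concatenated word amounts to reading its two parts with a common state at the
new junction. -/
theorem runs_iff_of_isSubdivision (h : P.IsSubdivision R eJ eO cut) (σ : S → Q) (τ : T → Q) :
    M.Runs P σ τ ↔ M.Runs R σ τ := by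
  constructor
  · rintro ⟨j, hj⟩
    choose q hs he using hj
    -- Reading the label of a cut segment passes through a state between the two parts; this state
    -- `m k` is placed on the new junction.
    have hm : ∀ k, ∃ r, M.Reaches (q (cut k)) (R.word (.inr (eJ (.inr k)))) r ∧
        M.EndsAt (Sum.elim τ j) (cut k)
          (R.label (Sum.map (Sum.map id (eJ ∘ Sum.inl)) eO (cut k))) r := fun k => by
      have := he (cut k)
      rwa [h.label_cut, endsAt_prefix] at this
    choose m hm hm' using hm
    obtain ⟨j', hj'⟩ : ∃ j' : J' → Q, j' ∘ eJ = Sum.elim j m :=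
      ⟨Sum.elim j m ∘ eJ.symm, by ext; simp⟩
    have hl : j' ∘ eJ ∘ Sum.inl = j := by rw [← Function.comp_assoc, hj', Sum.elim_comp_inl]
    have hr : ∀ k, j' (eJ (.inr k)) = m k := fun k => congrFun hj' (.inr k)
    refine ⟨j', fun e' => ?_⟩
    -- The ends inherited from `P`: such a segment of `R` is either the final part of a cut segment,
    -- read from `m k`, or an unchanged segment.
    have ho : ∀ e, ∃ r, M.StartsAt R (Sum.elim σ j') (Sum.map (Sum.map id (eJ ∘ Sum.inl)) eO e) r ∧
        M.EndsAt (Sum.elim τ j') (Sum.map (Sum.map id (eJ ∘ Sum.inl)) eO e)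
          (R.label (Sum.map (Sum.map id (eJ ∘ Sum.inl)) eO e)) r := fun e => by
      by_cases hc : ∃ k, e = cut k
      · obtain ⟨k, rfl⟩ := hc
        refine ⟨m k, ?_, ?_⟩
        · rw [startsAt_cut M h, Sum.elim_inr, hr]
        · rw [endsAt_map, elim_comp_map_id, hl]
          exact hm' k
      · refine ⟨q e, ?_, ?_⟩
        · rw [startsAt_old M h _ _ (not_exists.1 hc), elim_comp_map_id, hl]
          exact hs e
        · rw [endsAt_map, elim_comp_map_id, hl, ← h.label_old e (not_exists.1 hc)]
          exact he e
    rcases e' with e' | o'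
    · obtain ⟨a, rfl⟩ | ⟨k, rfl⟩ := exists_old_or_new eJ e'
      · exact ho (.inl a)
      -- The remaining segments end at a new junction: they are the initial parts, read from the
      -- original start to `m k`.
      · refine ⟨q (cut k), ?_, ?_⟩
        · rw [startsAt_new M h, elim_comp_map_id, hl]
          exact hs (cut k)
        · change M.Reaches _ (R.word _) (j' _)
          rw [hr]
          exact hm k
    · obtain ⟨o, rfl⟩ := eO.surjective o'
      exact ho (.inr o)
  · rintro ⟨j', hj'⟩
    refine ⟨j' ∘ eJ ∘ Sum.inl, fun e => ?_⟩
    obtain ⟨r, hr, hr'⟩ := hj' (Sum.map (Sum.map id (eJ ∘ Sum.inl)) eO e)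
    rw [endsAt_map, elim_comp_map_id] at hr'
    by_cases hc : ∃ k, e = cut k
    · obtain ⟨k, rfl⟩ := hc
      obtain ⟨q, hq, hq'⟩ := hj' (.inl (.inr (eJ (.inr k))))
      rw [startsAt_new M h, elim_comp_map_id] at hq
      rw [startsAt_cut M h] at hr
      refine ⟨q, hq, ?_⟩
      rw [h.label_cut, endsAt_prefix]
      -- The final part starts at the new junction, so `r` is the state there, which is also where
      -- the initial part ends.
      exact ⟨r, hr ▸ hq', hr'⟩
    · rw [startsAt_old M h _ _ (not_exists.1 hc), elim_comp_map_id] at hr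
      rw [← h.label_old e (not_exists.1 hc)] at hr'
      exact ⟨r, hr, hr'⟩

end subdivision

/-! ### Runs under relabelling, gluing and disjoint union -/

theorem runs_relabel (P : Diagram A S T J O) (s : S ≃ S') (t : T ≃ T') (σ : S' → Q) (τ : T' → Q) :
    M.Runs (P.relabel s t) σ τ ↔ M.Runs P (σ ∘ s) (τ ∘ t) := by
  refine exists_congr fun j => ?_
  have hb : Function.Bijective (Sum.map (Sum.map t id) id : (T ⊕ J) ⊕ O → (T' ⊕ J) ⊕ O) :=
    (((t.sumCongr (Equiv.refl J)).sumCongr (Equiv.refl O)).bijective)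
  refine (hb.surjective.forall).trans (forall_congr' fun e => exists_congr fun q => and_congr ?_ ?_)
  · rw [M.startsAt_congr (P := P) (R := P.relabel s t) (e := e) (Sum.map s id) (fun a ha => ?_)
      (fun b hb' => ?_), Sum.elim_comp_map, Function.comp_id]
    · subst ha
      rcases a with a | a <;> simp [Diagram.relabel]
    · refine ⟨Sum.map s.symm id b, ?_, hb.injective hb'⟩
      rcases b with b | b <;> simp
  · rw [endsAt_map, Sum.elim_comp_map, Function.comp_id]
    rcases e with (e | e) | e <;> simp [Diagram.label, Diagram.relabel]

/-- A glued point is a junction, which carries one state. Before gluing it is both a target and a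
source, and `m` forces the two states to agree. The quantifier over `m` is the sum over the glued
indices of a matrix. -/
theorem runs_glue (P : Diagram A (S ⊕ N) (T ⊕ N) J O) (σ : S → Q) (τ : T → Q) :
    M.Runs P.glue σ τ ↔ ∃ m : N → Q, M.Runs P (Sum.elim σ m) (Sum.elim τ m) := by
  -- For fixed states `j` at the old junctions and `m` at the glued points, the conditions coincide
  -- segment by segment.
  have key : ∀ (j : J → Q) (m : N → Q),
      (∀ e, ∃ q, M.StartsAt P.glue (Sum.elim σ (Sum.elim j m)) e q ∧
        M.EndsAt (Sum.elim τ (Sum.elim j m)) e (P.glue.label e) q) ↔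
      ∀ e, ∃ q, M.StartsAt P (Sum.elim (Sum.elim σ m) j) e q ∧
        M.EndsAt (Sum.elim (Sum.elim τ m) j) e (P.label e) q := fun j m => by
    have hr : ∀ (X : Type) (x : X → Q), Sum.elim x (Sum.elim j m) ∘ Diagram.regroup X N J =
        Sum.elim (Sum.elim x m) j := fun X x => by
      ext ((_ | _) | _) <;> rfl
    have hb : Function.Bijective
        (Sum.map (Diagram.regroup T N J) id : ((T ⊕ N) ⊕ J) ⊕ O → (T ⊕ (J ⊕ N)) ⊕ O) :=
      ((Diagram.regroup T N J).sumCongr (Equiv.refl O)).bijective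
    refine (hb.surjective.forall).trans
      (forall_congr' fun e => exists_congr fun q => and_congr ?_ ?_)
    · rw [M.startsAt_congr (P := P) (R := P.glue) (e := e) (Diagram.regroup S N J) (fun a ha => ?_)
        (fun b hb' => ?_), hr]
      · simp [Diagram.glue, ha]
      · exact ⟨(Diagram.regroup S N J).symm b, by simp, hb.injective hb'⟩
    · rw [endsAt_map, hr]
      rcases e with e | e <;> simp [Diagram.label, Diagram.glue]
  constructor
  · rintro ⟨j, h⟩
    refine ⟨j ∘ .inr, j ∘ .inl, (key _ _).1 ?_⟩
    rwa [Sum.elim_comp_inl_inr]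
  · rintro ⟨m, j, h⟩
    exact ⟨Sum.elim j m, (key _ _).2 h⟩

/-- No segment of one piece starts at a point of the other, so the conditions on the two pieces
involve disjoint sets of states and can be met independently. -/
theorem runs_disj (P : Diagram A S T J O) (R : Diagram A S' T' J' O') (σ : S → Q) (τ : T → Q)
    (σ' : S' → Q) (τ' : T' → Q) :
    M.Runs (P.disj R) (Sum.elim σ σ') (Sum.elim τ τ') ↔ M.Runs P σ τ ∧ M.Runs R σ' τ' := by
  have hl : ∀ (j : J → Q) (j' : J' → Q) (e : (T ⊕ J) ⊕ O) (q : Q),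
      (M.StartsAt (P.disj R) (Sum.elim (Sum.elim σ σ') (Sum.elim j j'))
          (Sum.map (Sum.map Sum.inl Sum.inl) Sum.inl e) q ∧
        M.EndsAt (Sum.elim (Sum.elim τ τ') (Sum.elim j j'))
          (Sum.map (Sum.map Sum.inl Sum.inl) (Sum.inl : O → O ⊕ O') e)
          ((P.disj R).label (Sum.map (Sum.map Sum.inl Sum.inl) Sum.inl e)) q) ↔
      (M.StartsAt P (Sum.elim σ j) e q ∧ M.EndsAt (Sum.elim τ j) e (P.label e) q) := by
    intro j j' e q
    refine and_congr ?_ ?_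
    · rw [M.startsAt_congr (P := P) (R := P.disj R) (e := e) (Sum.map Sum.inl Sum.inl)
        (fun a ha => ?_) (fun b hb => ?_), Sum.elim_comp_map, Sum.elim_comp_inl, Sum.elim_comp_inl]
      · subst ha
        rcases a with a | a <;> simp [Diagram.disj, Equiv.sumSumSumComm]
      · have hi := ((Sum.inl_injective (α := T) (β := T')).sumMap
          (Sum.inl_injective (α := J) (β := J'))).sumMap (Sum.inl_injective (α := O) (β := O'))
        rcases b with (b | b) | (b | b)
        · exact ⟨.inl b, rfl, hi hb⟩
        -- A segment that starts at a point of `R` lies in the right summand and cannot be a segment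
        -- of `P`.
        · exfalso
          revert hb
          simp only [Diagram.disj, Equiv.sumSumSumComm]
          simp
          rcases R.next (Sum.inl b) with (_ | _) | _ <;> rcases e with (_ | _) | _ <;> simp
        · exact ⟨.inr b, rfl, hi hb⟩
        · exfalso
          revert hb
          simp only [Diagram.disj, Equiv.sumSumSumComm]
          simp
          rcases R.next (Sum.inr b) with (_ | _) | _ <;> rcases e with (_ | _) | _ <;> simp
    · rw [endsAt_map, Sum.elim_comp_map, Sum.elim_comp_inl, Sum.elim_comp_inl]
      rcases e with (e | e) | e <;> rfl
  have hr : ∀ (j : J → Q) (j' : J' → Q) (e : (T' ⊕ J') ⊕ O') (q : Q),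
      (M.StartsAt (P.disj R) (Sum.elim (Sum.elim σ σ') (Sum.elim j j'))
          (Sum.map (Sum.map Sum.inr Sum.inr) Sum.inr e) q ∧
        M.EndsAt (Sum.elim (Sum.elim τ τ') (Sum.elim j j'))
          (Sum.map (Sum.map Sum.inr Sum.inr) (Sum.inr : O' → O ⊕ O') e)
          ((P.disj R).label (Sum.map (Sum.map Sum.inr Sum.inr) Sum.inr e)) q) ↔
      (M.StartsAt R (Sum.elim σ' j') e q ∧ M.EndsAt (Sum.elim τ' j') e (R.label e) q) := by
    intro j j' e q
    refine and_congr ?_ ?_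
    · rw [M.startsAt_congr (P := R) (R := P.disj R) (e := e) (Sum.map Sum.inr Sum.inr)
        (fun a ha => ?_) (fun b hb => ?_), Sum.elim_comp_map, Sum.elim_comp_inr, Sum.elim_comp_inr]
      · subst ha
        rcases a with a | a <;> simp [Diagram.disj, Equiv.sumSumSumComm]
      · have hi := ((Sum.inr_injective (α := T) (β := T')).sumMap
          (Sum.inr_injective (α := J) (β := J'))).sumMap (Sum.inr_injective (α := O) (β := O'))
        rcases b with (b | b) | (b | b)
        · exfalso
          revert hb
          simp only [Diagram.disj, Equiv.sumSumSumComm]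
          simp
          rcases P.next (Sum.inl b) with (_ | _) | _ <;> rcases e with (_ | _) | _ <;> simp
        · exact ⟨.inl b, rfl, hi hb⟩
        · exfalso
          revert hb
          simp only [Diagram.disj, Equiv.sumSumSumComm]
          simp
          rcases P.next (Sum.inr b) with (_ | _) | _ <;> rcases e with (_ | _) | _ <;> simp
        · exact ⟨.inr b, rfl, hi hb⟩
    · rw [endsAt_map, Sum.elim_comp_map, Sum.elim_comp_inr, Sum.elim_comp_inr]
      rcases e with (e | e) | e <;> rfl
  constructor
  · rintro ⟨j, h⟩
    rw [← Sum.elim_comp_inl_inr j] at h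
    refine ⟨⟨j ∘ Sum.inl, fun e => ?_⟩, ⟨j ∘ Sum.inr, fun e => ?_⟩⟩
    · obtain ⟨q, hq⟩ := h (Sum.map (Sum.map Sum.inl Sum.inl) (Sum.inl : O → O ⊕ O') e)
      exact ⟨q, (hl _ _ _ _).1 hq⟩
    · obtain ⟨q, hq⟩ := h (Sum.map (Sum.map Sum.inr Sum.inr) (Sum.inr : O' → O ⊕ O') e)
      exact ⟨q, (hr _ _ _ _).1 hq⟩
  · rintro ⟨⟨j, h⟩, ⟨j', h'⟩⟩
    have hP : ∀ e, _ := fun e => (h e).imp fun q hq => (hl j j' e q).2 hq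
    have hR : ∀ e, _ := fun e => (h' e).imp fun q hq => (hr j j' e q).2 hq
    refine ⟨Sum.elim j j', ?_⟩
    rintro (((e | e) | (e | e)) | (e | e))
    · exact hP (.inl (.inl e))
    · exact hR (.inl (.inl e))
    · exact hP (.inl (.inr e))
    · exact hR (.inl (.inr e))
    · exact hP (.inr e)
    · exact hR (.inr e)

/-- There are no junctions, and every segment starts at a source, so initial states play no role. -/
theorem runs_arcs (e : S ≃ T) (w : T → List A) (σ : S → Q) (τ : T → Q) :
    M.Runs (Diagram.arcs e w) σ τ ↔ ∀ s, M.Reaches (σ s) (w (e s)) (τ (e s)) := by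
  have hn : ∀ s, (Diagram.arcs e w).next (.inl s) = .inl (.inl (e s)) := fun _ => rfl
  constructor
  · rintro ⟨j, h⟩ s
    obtain ⟨q, hq, hq'⟩ := h (.inl (.inl (e s)))
    rw [← hn, startsAt_next] at hq
    subst hq
    exact hq'
  · refine fun h => ⟨Empty.elim, ?_⟩
    rintro ((t | ⟨⟨⟩⟩) | ⟨⟨⟩⟩)
    obtain ⟨s, rfl⟩ := e.surjective t
    refine ⟨σ s, ?_, h s⟩
    rw [← hn, startsAt_next]
    rfl

/-- The automaton can run along the cobordism with the states `σ` at the sources and `τ` at the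
targets. -/
def RunsAlong (f : Cobordism A S T) (σ : S → Q) (τ : T → Q) : Prop :=
  Quot.lift (fun P : Presentation A S T => M.Runs P.diagram σ τ)
    (fun _ _ ⟨_, _, _, _, h⟩ => propext (M.runs_iff_of_isSubdivision h σ τ)) f

theorem runsAlong_relabel (f : Cobordism A S T) (s : S ≃ S') (t : T ≃ T') (σ : S' → Q)
    (τ : T' → Q) : M.RunsAlong (f.relabel s t) σ τ ↔ M.RunsAlong f (σ ∘ s) (τ ∘ t) := by
  induction f using Cobordism.ind with | _ J O P
  exact M.runs_relabel P s t σ τ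

theorem runsAlong_glue [Finite N] (f : Cobordism A (S ⊕ N) (T ⊕ N)) (σ : S → Q) (τ : T → Q) :
    M.RunsAlong f.glue σ τ ↔ ∃ m : N → Q, M.RunsAlong f (Sum.elim σ m) (Sum.elim τ m) := by
  induction f using Cobordism.ind with | _ J O P
  exact M.runs_glue P σ τ

theorem runsAlong_disj (f : Cobordism A S T) (g : Cobordism A S' T') (σ : S → Q) (τ : T → Q)
    (σ' : S' → Q) (τ' : T' → Q) :
    M.RunsAlong (f.disj g) (Sum.elim σ σ') (Sum.elim τ τ') ↔
      M.RunsAlong f σ τ ∧ M.RunsAlong g σ' τ' := by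
  induction f using Cobordism.ind with | _ J O P
  induction g using Cobordism.ind with | _ J' O' R
  exact M.runs_disj P R σ τ σ' τ'

end MullerAutomaton

/-! ### Arithmetic of `𝔹` as logic -/

namespace 𝔹

instance : Nontrivial 𝔹 := ⟨0, 1, by rintro ⟨⟩⟩

/-- As `𝔹` has two elements, an equation in it is an equivalence of propositions; coefficients are
compared in this way throughout. -/
theorem ext_iff_eq_one {x y : 𝔹} : x = y ↔ (x = 1 ↔ y = 1) := by
  refine ⟨fun h => by rw [h], fun h => ?_⟩
  rcases x with _ | _ <;> rcases y with _ | _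
  · rfl
  · exact h.2 rfl
  · exact (h.1 rfl).symm
  · rfl

theorem add_eq_one {x y : 𝔹} : x + y = 1 ↔ x = 1 ∨ y = 1 := by
  rcases x with _ | _
  · exact ⟨.inr, fun h => h.resolve_left zero_ne_one⟩
  · exact ⟨fun _ => .inl rfl, fun _ => rfl⟩

theorem mul_eq_one {x y : 𝔹} : x * y = 1 ↔ x = 1 ∧ y = 1 := by
  rcases x with _ | _
  · exact ⟨fun h => absurd h zero_ne_one, fun h => absurd h.1 zero_ne_one⟩
  · exact ⟨fun h => ⟨rfl, h⟩, fun h => h.2⟩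

/-- Addition is disjunction, so a finite sum is an existential quantifier. This turns matrix
products into composition of relations. -/
theorem sum_eq_one {ι : Type*} {s : Finset ι} {f : ι → 𝔹} :
    ∑ i ∈ s, f i = 1 ↔ ∃ i ∈ s, f i = 1 := by
  classical
  induction s using Finset.induction_on with
  | empty => simp
  | insert i s hi ih => rw [Finset.sum_insert hi, add_eq_one, ih]; simp

end 𝔹

/-! ### Linear maps given by relations -/

section linear

variable {α β γ : Type}

theorem single_one_apply_eq_one {a b : α} :
    (Finsupp.single a 1 : α →₀ 𝔹) b = 1 ↔ b = a := by
  classical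
  simp [Finsupp.single_apply, eq_comm]

theorem finsupp_ext_iff_eq_one {f g : α →₀ 𝔹} : f = g ↔ ∀ a, f a = 1 ↔ g a = 1 := by
  rw [Finsupp.ext_iff]
  exact forall_congr' fun _ => 𝔹.ext_iff_eq_one

open Classical in
/-- The linear map of free `𝔹`-semimodules whose matrix is a relation. -/
noncomputable def relMap [Finite β] (r : α → β → Prop) : (α →₀ 𝔹) →ₗ[𝔹] (β →₀ 𝔹) :=
  Finsupp.linearCombination 𝔹
    (fun a => Finsupp.equivFunOnFinite.symm (fun b => if r a b then 1 else 0))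

theorem relMap_apply_eq_one [Finite β] (r : α → β → Prop) (f : α →₀ 𝔹) (b : β) :
    relMap r f b = 1 ↔ ∃ a, f a = 1 ∧ r a b := by
  classical
  rw [relMap, Finsupp.linearCombination_apply, Finsupp.sum, Finsupp.finsetSum_apply,
    𝔹.sum_eq_one]
  refine exists_congr fun a => ?_
  simp only [Finsupp.smul_apply, smul_eq_mul, 𝔹.mul_eq_one,
    Finsupp.equivFunOnFinite_symm_apply_apply, Finsupp.mem_support_iff]
  constructor
  · rintro ⟨-, h, h'⟩
    refine ⟨h, ?_⟩
    by_contra hr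
    rw [if_neg hr] at h'
    exact zero_ne_one h'
  · rintro ⟨h, h'⟩
    exact ⟨by rw [h]; exact zero_ne_one.symm, h, if_pos h'⟩

theorem relMap_single_apply_eq_one [Finite β] (r : α → β → Prop) (a : α) (b : β) :
    relMap r (Finsupp.single a 1) b = 1 ↔ r a b := by
  simp [relMap_apply_eq_one, single_one_apply_eq_one]

/-- Used for cylinders, whose relations are graphs of bijections. -/
theorem relMap_single_of_unique [Finite β] {r : α → β → Prop} {a : α} {b : β}
    (h : ∀ b', r a b' ↔ b' = b) : relMap r (Finsupp.single a 1) = Finsupp.single b 1 := by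
  rw [finsupp_ext_iff_eq_one]
  intro b'
  rw [relMap_single_apply_eq_one, single_one_apply_eq_one, h]

theorem linearMap_finsupp_ext {M : Type} [AddCommMonoid M] [Module 𝔹 M]
    {f g : (α →₀ 𝔹) →ₗ[𝔹] M}
    (h : ∀ a, f (Finsupp.single a 1) = g (Finsupp.single a 1)) : f = g :=
  Finsupp.lhom_ext' fun a => LinearMap.ext_ring (h a)

theorem linearMap_finsupp_tensor_ext {M : Type} [AddCommMonoid M] [Module 𝔹 M]
    {f g : (α →₀ 𝔹) ⊗[𝔹] (β →₀ 𝔹) →ₗ[𝔹] M}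
    (h : ∀ a b, f (Finsupp.single a 1 ⊗ₜ Finsupp.single b 1) =
      g (Finsupp.single a 1 ⊗ₜ Finsupp.single b 1)) : f = g :=
  TensorProduct.ext (linearMap_finsupp_ext fun a => linearMap_finsupp_ext fun b => h a b)

theorem linearMap_finsupp_tensor_tensor_ext {M : Type} [AddCommMonoid M] [Module 𝔹 M]
    {f g : ((α →₀ 𝔹) ⊗[𝔹] (β →₀ 𝔹)) ⊗[𝔹] (γ →₀ 𝔹) →ₗ[𝔹] M}
    (h : ∀ a b c, f ((Finsupp.single a 1 ⊗ₜ Finsupp.single b 1) ⊗ₜ Finsupp.single c 1) =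
      g ((Finsupp.single a 1 ⊗ₜ Finsupp.single b 1) ⊗ₜ Finsupp.single c 1)) : f = g :=
  TensorProduct.ext (linearMap_finsupp_tensor_ext fun a b => linearMap_finsupp_ext fun c =>
    h a b c)

end linear

/-! ### The state-sum functor and its symmetric monoidal structure -/

namespace MullerAutomaton

variable {A Q : Type} (M : MullerAutomaton A Q)

/-- The assignments of states to the points of a `0`-manifold. -/
abbrev States (Q : Type) (X : OrientedPoints A) : Type := (X.pos → Q) × (X.neg → Q)

/-- The automaton can run along the cobordism `f`, with the states `x` at the bottom and `y` at the
top. -/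
def Rel {X Y : OrientedPoints A} (f : X ⟶ Y) (x : States Q X) (y : States Q Y) : Prop :=
  M.RunsAlong (S := X.pos ⊕ Y.neg) (T := X.neg ⊕ Y.pos) f (Sum.elim x.1 y.2) (Sum.elim x.2 y.1)

/-- Composition is disjoint union followed by gluing along the points of `Y`, and the states at the
glued points form an assignment `y`. At negative points the target belongs to `g` and the source to
`f`, which makes no difference to the shared state. -/
theorem rel_comp {X Y Z : OrientedPoints A} (f : X ⟶ Y) (g : Y ⟶ Z) (x : States Q X)
    (z : States Q Z) : M.Rel (f ≫ g) x z ↔ ∃ y, M.Rel f x y ∧ M.Rel g y z := by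
  change M.RunsAlong (Cobordism.comp f g) _ _ ↔ _
  rw [Cobordism.comp, runsAlong_glue]
  have key : ∀ m : Y.pos ⊕ Y.neg → Q,
      M.RunsAlong (Cobordism.relabel (Cobordism.srcEquiv X.pos Y.neg Y.pos Z.neg)
        (Cobordism.tgtEquiv X.neg Y.pos Y.neg Z.pos) (Cobordism.disj f g))
        (Sum.elim (Sum.elim x.1 z.2) m) (Sum.elim (Sum.elim x.2 z.1) m) ↔
      M.Rel f x (m ∘ .inl, m ∘ .inr) ∧ M.Rel g (m ∘ .inl, m ∘ .inr) z := fun m => by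
    rw [runsAlong_relabel]
    refine Iff.trans (iff_of_eq ?_) (M.runsAlong_disj f g _ _ _ _)
    congr 1
    · ext ((_ | _) | (_ | _)) <;> rfl
    · ext ((_ | _) | (_ | _)) <;> rfl
  constructor
  · rintro ⟨m, h⟩
    exact ⟨_, (key m).1 h⟩
  · rintro ⟨y, h⟩
    exact ⟨Sum.elim y.1 y.2, (key _).2 h⟩

theorem rel_cylIso {X Y : OrientedPoints A} (p : X.pos ≃ Y.pos) (n : X.neg ≃ Y.neg)
    (x : States Q X) (y : States Q Y) : M.Rel (OrientedPoints.cylIso p n).hom x y ↔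
      y = (x.1 ∘ p.symm, x.2 ∘ n.symm) := by
  refine (M.runs_arcs _ _ _ _).trans ?_
  rw [Prod.ext_iff, Equiv.eq_comp_symm, Equiv.eq_comp_symm]
  constructor
  · intro h
    refine ⟨funext fun a => (h (.inl a)).symm, funext fun b => ?_⟩
    -- Negative strands run downward: the source is the top point `n b` and the target is `b`.
    have := h (.inr (n b))
    simpa [Reaches] using this
  · rintro ⟨h1, h2⟩ (a | b)
    · exact (congrFun h1 a).symm
    · obtain ⟨b, rfl⟩ := n.surjective b
      simpa [Reaches] using congrFun h2 b

theorem rel_id (X : OrientedPoints A) (x y : States Q X) : M.Rel (𝟙 X) x y ↔ y = x :=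
  M.rel_cylIso (Equiv.refl _) (Equiv.refl _) x y

/-- The states on a disjoint union. -/
def statesTensor (X Y : OrientedPoints A) : States Q X × States Q Y ≃ States Q (X ⊗ Y) where
  toFun s := (Sum.elim s.1.1 s.2.1, Sum.elim s.1.2 s.2.2)
  invFun s := ((s.1 ∘ .inl, s.2 ∘ .inl), (s.1 ∘ .inr, s.2 ∘ .inr))
  left_inv _ := rfl
  right_inv _ := Prod.ext (Sum.elim_comp_inl_inr _) (Sum.elim_comp_inl_inr _)

theorem rel_tensorHom {X Y X' Y' : OrientedPoints A} (f : X ⟶ Y) (g : X' ⟶ Y') (x : States Q X)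
    (y : States Q Y) (x' : States Q X') (y' : States Q Y') :
    M.Rel (f ⊗ₘ g) (statesTensor X X' (x, x')) (statesTensor Y Y' (y, y')) ↔
      M.Rel f x y ∧ M.Rel g x' y' := by
  refine (M.runsAlong_relabel (Cobordism.disj f g) _ _ _ _).trans ?_
  refine Iff.trans (iff_of_eq ?_) (M.runsAlong_disj f g _ _ _ _)
  congr 1
  · ext ((_ | _) | (_ | _)) <;> rfl
  · ext ((_ | _) | (_ | _)) <;> rfl

/-- The free module on the states of a disjoint union is the tensor product. -/
noncomputable def tensorEquiv (X Y : OrientedPoints A) :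
    (States Q X →₀ 𝔹) ⊗[𝔹] (States Q Y →₀ 𝔹) ≃ₗ[𝔹] (States Q (X ⊗ Y) →₀ 𝔹) :=
  finsuppTensorFinsupp' 𝔹 (States Q X) (States Q Y) ≪≫ₗ Finsupp.domLCongr (statesTensor X Y)

theorem tensorEquiv_single (X Y : OrientedPoints A) (x : States Q X) (y : States Q Y) :
    tensorEquiv X Y (Finsupp.single x 1 ⊗ₜ Finsupp.single y 1) =
      Finsupp.single (statesTensor X Y (x, y)) 1 := by
  simp [tensorEquiv, finsuppTensorFinsupp'_single_tmul_single]

theorem tensorEquiv_tmul_apply (X Y : OrientedPoints A) (f : States Q X →₀ 𝔹)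
    (g : States Q Y →₀ 𝔹) (x : States Q X) (y : States Q Y) :
    tensorEquiv X Y (f ⊗ₜ g) (statesTensor X Y (x, y)) = f x * g y := by
  simp [tensorEquiv, Finsupp.domLCongr_apply]

noncomputable instance (X : OrientedPoints A) [IsEmpty X.pos] [IsEmpty X.neg] :
    Unique (States Q X) where
  default := (isEmptyElim, isEmptyElim)
  uniq _ := Prod.ext (Subsingleton.elim _ _) (Subsingleton.elim _ _)

/-- The free module on the states of the empty manifold is `𝔹`. -/
noncomputable def unitEquiv : 𝔹 ≃ₗ[𝔹] (States Q (𝟙_ (OrientedPoints A)) →₀ 𝔹) :=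
  (Finsupp.uniqueLinearEquiv 𝔹 𝔹 default).symm

theorem unitEquiv_one : unitEquiv (A := A) (Q := Q) 1 = Finsupp.single default 1 := by
  rw [unitEquiv, LinearEquiv.symm_apply_eq]
  simp

variable [Finite Q]

/-- The functor that is represented by the matrices `Rel`. -/
noncomputable def tqft : OrientedPoints A ⥤ FreeBMod where
  obj X := ⟨SemimoduleCat.of 𝔹 (States Q X →₀ 𝔹), inferInstanceAs (Module.Free 𝔹 (_ →₀ 𝔹))⟩
  map {X Y} f := ObjectProperty.homMk (SemimoduleCat.ofHom (relMap (M.Rel f)))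
  map_id X := by
    apply ObjectProperty.hom_ext
    apply SemimoduleCat.hom_ext
    exact linearMap_finsupp_ext fun x => relMap_single_of_unique fun y => M.rel_id X x y
  map_comp {X Y Z} f g := by
    apply ObjectProperty.hom_ext
    apply SemimoduleCat.hom_ext
    refine linearMap_finsupp_ext fun x => finsupp_ext_iff_eq_one.2 fun z => ?_
    change relMap (M.Rel (f ≫ g)) _ z = 1 ↔ relMap (M.Rel g) (relMap (M.Rel f) _) z = 1
    -- The coefficient of the composite of the two matrices is `1` exactly when some assignment on
    -- `Y` is related to both `x` and `z`.
    rw [relMap_single_apply_eq_one, relMap_apply_eq_one, rel_comp]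
    simp only [relMap_single_apply_eq_one]

/-- Naturality of the tensor structure on basis tensors: at each pair of assignments both
coefficients express the conjunction of the two relations. -/
theorem relMap_tensorHom {X Y X' Y' : OrientedPoints A} (f : X ⟶ Y) (g : X' ⟶ Y')
    (x : States Q X) (x' : States Q X') :
    tensorEquiv Y Y' (relMap (M.Rel f) (Finsupp.single x 1) ⊗ₜ
      relMap (M.Rel g) (Finsupp.single x' 1)) =
      relMap (M.Rel (f ⊗ₘ g)) (tensorEquiv X X' (Finsupp.single x 1 ⊗ₜ Finsupp.single x' 1)) := by
  rw [finsupp_ext_iff_eq_one]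
  intro z
  obtain ⟨⟨y, y'⟩, rfl⟩ := (statesTensor Y Y').surjective z
  rw [tensorEquiv_tmul_apply, 𝔹.mul_eq_one, tensorEquiv_single, relMap_single_apply_eq_one,
    relMap_single_apply_eq_one, relMap_single_apply_eq_one, rel_tensorHom]

theorem relMap_cylIso {X Y : OrientedPoints A} (p : X.pos ≃ Y.pos) (n : X.neg ≃ Y.neg)
    (x : States Q X) : relMap (M.Rel (OrientedPoints.cylIso p n).hom) (Finsupp.single x 1) =
      Finsupp.single (x.1 ∘ p.symm, x.2 ∘ n.symm) 1 :=
  relMap_single_of_unique fun y => M.rel_cylIso p n x y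

theorem relMap_id (X : OrientedPoints A) (x : States Q X) :
    relMap (M.Rel (𝟙 X)) (Finsupp.single x 1) = Finsupp.single x 1 :=
  relMap_single_of_unique fun y => M.rel_id X x y

/-- The monoidal structure of `tqft`. -/
noncomputable def tqftCoreMonoidal : M.tqft.CoreMonoidal where
  εIso := isFree.isoMk (X := 𝟙_ FreeBMod) (Y := M.tqft.obj (𝟙_ _)) unitEquiv.toModuleIsoₛ
  μIso X Y := isFree.isoMk (X := M.tqft.obj X ⊗ M.tqft.obj Y) (Y := M.tqft.obj (X ⊗ Y))
    (tensorEquiv X Y).toModuleIsoₛ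
  μIso_hom_natural_left {X Y} f Z := by
    apply ObjectProperty.hom_ext
    apply SemimoduleCat.hom_ext
    refine linearMap_finsupp_tensor_ext fun x z => ?_
    -- Whiskering is tensoring with an identity, whose matrix fixes basis vectors.
    have := M.relMap_tensorHom f (𝟙 Z) x z
    rw [relMap_id] at this
    exact this
  μIso_hom_natural_right {X Y} Z f := by
    apply ObjectProperty.hom_ext
    apply SemimoduleCat.hom_ext
    refine linearMap_finsupp_tensor_ext fun z x => ?_
    have := M.relMap_tensorHom (𝟙 Z) f z x
    rw [relMap_id] at this
    exact this
  associativity X Y Z := by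
    apply ObjectProperty.hom_ext
    apply SemimoduleCat.hom_ext
    refine linearMap_finsupp_tensor_tensor_ext fun x y z => ?_
    -- The associator is a cylinder and so permutes basis vectors; what remains is an equality of
    -- two assignments on a threefold disjoint union.
    change relMap (M.Rel (OrientedPoints.cylIso _ _).hom) (tensorEquiv (X ⊗ Y) Z
      (tensorEquiv X Y (Finsupp.single x 1 ⊗ₜ Finsupp.single y 1) ⊗ₜ Finsupp.single z 1)) =
      tensorEquiv X (Y ⊗ Z) (Finsupp.single x 1 ⊗ₜ
        tensorEquiv Y Z (Finsupp.single y 1 ⊗ₜ Finsupp.single z 1))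
    simp only [tensorEquiv_single]
    rw [relMap_cylIso]
    congr 1
    refine Prod.ext ?_ ?_ <;> ext (_ | _ | _) <;> rfl
  left_unitality X := by
    apply ObjectProperty.hom_ext
    apply SemimoduleCat.hom_ext
    refine TensorProduct.ext (LinearMap.ext_ring (linearMap_finsupp_ext fun x => ?_))
    -- It suffices to test on the generator `1` of `𝔹`, which becomes the unique assignment on the
    -- empty manifold.
    change (1 : 𝔹) • Finsupp.single x 1 = relMap (M.Rel (OrientedPoints.cylIso _ _).hom)
      (tensorEquiv (𝟙_ _) X (unitEquiv 1 ⊗ₜ Finsupp.single x 1))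
    rw [unitEquiv_one, tensorEquiv_single, relMap_cylIso, one_smul]
    rfl
  right_unitality X := by
    apply ObjectProperty.hom_ext
    apply SemimoduleCat.hom_ext
    refine TensorProduct.ext (linearMap_finsupp_ext fun x => LinearMap.ext_ring ?_)
    change (1 : 𝔹) • Finsupp.single x 1 = relMap (M.Rel (OrientedPoints.cylIso _ _).hom)
      (tensorEquiv X (𝟙_ _) (Finsupp.single x 1 ⊗ₜ unitEquiv 1))
    rw [unitEquiv_one, tensorEquiv_single, relMap_cylIso, one_smul]
    rfl

noncomputable instance : M.tqft.Monoidal := M.tqftCoreMonoidal.toMonoidal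

noncomputable instance : M.tqft.Braided where
  braided X Y := by
    apply ObjectProperty.hom_ext
    apply SemimoduleCat.hom_ext
    refine linearMap_finsupp_tensor_ext fun x y => ?_
    change relMap (M.Rel (OrientedPoints.cylIso _ _).hom) (tensorEquiv X Y
      (Finsupp.single x 1 ⊗ₜ Finsupp.single y 1)) =
      tensorEquiv Y X (Finsupp.single y 1 ⊗ₜ Finsupp.single x 1)
    simp only [tensorEquiv_single]
    rw [relMap_cylIso]
    congr 1
    refine Prod.ext ?_ ?_ <;> ext (_ | _) <;> rfl

end MullerAutomaton

/-! ### Bases, and runs along the elementary cobordisms -/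

theorem basisSingleOne_reindex_apply {α β : Type} (e : α ≃ β) (b : β) :
    (Finsupp.basisSingleOne (R := 𝔹)).reindex e b = Finsupp.single (e.symm b) 1 := by
  rw [Module.Basis.reindex_apply, Finsupp.coe_basisSingleOne]

theorem basisSingleOne_reindex_repr {α β : Type} (e : α ≃ β) (v : α →₀ 𝔹) (b : β) :
    ((Finsupp.basisSingleOne (R := 𝔹)).reindex e).repr v b = v (e.symm b) :=
  Module.Basis.repr_reindex_apply _ _ _ _

namespace MullerAutomaton

variable {A Q : Type} (M : MullerAutomaton A Q)

/-- The state `q` at a positive point. -/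
def plusState (q : Q) : States Q (points (plus : CobH A)) :=
  (fun _ => q, isEmptyElim (α := Points .minus [.plus]))

/-- The state `q` at a negative point. -/
def minusState (q : Q) : States Q (points (minus : CobH A)) :=
  (isEmptyElim (α := Points .plus [.minus]), fun _ => q)

/-- The states at a positive and a negative point. -/
def pairState {l : List Sgn} (q q' : Q) : States Q (points (A := A) ⟨l⟩) :=
  (fun _ => q, fun _ => q')

/-- The states on the empty sequence. -/
def nilState : States Q (points (𝟙_ (CobH A))) :=
  (isEmptyElim (α := Points .plus []), isEmptyElim (α := Points .minus []))

theorem eq_nilState (x : States Q (points (𝟙_ (CobH A)))) : x = nilState := by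
  have : IsEmpty (points (𝟙_ (CobH A))).pos := inferInstanceAs (IsEmpty (Points .plus []))
  have : IsEmpty (points (𝟙_ (CobH A))).neg := inferInstanceAs (IsEmpty (Points .minus []))
  exact Subsingleton.elim _ _

/-- The states of a positive point. -/
def plusStateEquiv : States Q (points (plus : CobH A)) ≃ Q where
  toFun x := x.1 (default : Points .plus [.plus])
  invFun := plusState
  left_inv x := Prod.ext
    (funext fun _ => congrArg x.1 (Subsingleton.elim (α := Points .plus [.plus]) _ _))
    (funext fun p => isEmptyElim (α := Points .minus [.plus]) p)
  right_inv _ := rfl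

/-- The states of a negative point. -/
def minusStateEquiv : States Q (points (minus : CobH A)) ≃ Q where
  toFun x := x.2 (default : Points .minus [.minus])
  invFun := minusState
  left_inv x := Prod.ext (funext fun p => isEmptyElim (α := Points .plus [.minus]) p)
    (funext fun _ => congrArg x.2 (Subsingleton.elim (α := Points .minus [.minus]) _ _))
  right_inv _ := rfl

/-- The cup is an arc from the negative to the positive point with the empty word, and a path
spelling the empty word does not move. -/
theorem rel_cup (y : States Q (points (A := A) ⟨[.plus, .minus]⟩)) :
    M.Rel (X := points (𝟙_ (CobH A))) (Y := points (A := A) ⟨[.plus, .minus]⟩) cup nilState y ↔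
      ∃ q, y = pairState q q := by
  refine (M.runs_arcs _ _ _ _).trans ?_
  constructor
  · intro h
    have h' : y.2 (default : Points .minus [.plus, .minus]) =
      y.1 (default : Points .plus [.plus, .minus]) :=
      h (.inr (default : Points .minus [.plus, .minus]))
    refine ⟨y.1 (default : Points .plus [.plus, .minus]), Prod.ext (funext fun p => ?_)
      (funext fun p => ?_)⟩
    · exact congrArg y.1 (Subsingleton.elim (α := Points .plus [.plus, .minus]) _ _)
    · refine Eq.trans ?_ h'
      exact congrArg y.2 (Subsingleton.elim (α := Points .minus [.plus, .minus]) _ _)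
  · rintro ⟨q, rfl⟩ (s | s)
    · exact isEmptyElim (α := Points .plus []) s
    · rfl

theorem rel_cap (q q' : Q) :
    M.Rel (X := points (A := A) ⟨[.plus, .minus]⟩) (Y := points (𝟙_ (CobH A))) cap
      (pairState q q') nilState ↔ q = q' := by
  refine (M.runs_arcs _ _ _ _).trans ⟨fun h => h (.inl (default : Points .plus [.plus, .minus])), ?_⟩
  rintro rfl (s | s)
  · rfl
  · exact isEmptyElim (α := Points .minus []) s

theorem rel_cap' (q q' : Q) :
    M.Rel (X := points (A := A) ⟨[.minus, .plus]⟩) (Y := points (𝟙_ (CobH A))) cap'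
      (pairState q q') nilState ↔ q = q' := by
  refine (M.runs_arcs _ _ _ _).trans ⟨fun h => h (.inl (default : Points .plus [.minus, .plus])), ?_⟩
  rintro rfl (s | s)
  · rfl
  · exact isEmptyElim (α := Points .minus []) s

theorem rel_strand_plus (w : List A) (q q' : Q) :
    M.Rel (X := points (plus : CobH A)) (Y := points (plus : CobH A)) (strand .plus w)
      (plusState q) (plusState q') ↔ M.Reaches q w q' := by
  refine (M.runs_arcs _ _ _ _).trans ⟨fun h => h (.inl (default : Points .plus [.plus])), ?_⟩
  rintro h (s | s)
  · exact h
  · exact isEmptyElim (α := Points .minus [.plus]) s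

/-- The strand is read from top to bottom, so the path starts at the top state `q`. This reversal
yields the dual map. -/
theorem rel_strand_minus (w : List A) (q q' : Q) :
    M.Rel (X := points (minus : CobH A)) (Y := points (minus : CobH A)) (strand .minus w)
      (minusState q') (minusState q) ↔ M.Reaches q w q' := by
  refine (M.runs_arcs _ _ _ _).trans ⟨fun h => h (.inr (default : Points .minus [.minus])), ?_⟩
  rintro h (s | s)
  · exact isEmptyElim (α := Points .plus [.minus]) s
  · exact h

/-- The diagram has neither sources nor junctions, so its only segment starts at an inner endpoint,
in an initial state. -/
theorem rel_inHalf (w : List A) (q : Q) :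
    M.Rel (X := points (𝟙_ (CobH A))) (Y := points (plus : CobH A)) (inHalf w)
      nilState (plusState q) ↔ ∃ q₀ ∈ M.init, M.Reaches q₀ w q := by
  constructor
  · rintro ⟨j, h⟩
    obtain ⟨q₀, ⟨a, -⟩ | ⟨-, hq⟩, h'⟩ := h (.inl (.inl (.inr (default : Points .plus [.plus]))))
    · exact isEmptyElim (α := (Points .plus [] ⊕ Points .minus [.plus]) ⊕ Empty) a
    · exact ⟨q₀, hq, h'⟩
  · rintro ⟨q₀, hq, h⟩
    refine ⟨Empty.elim, ?_⟩
    rintro (((e | e) | ⟨⟨⟩⟩) | ⟨⟨⟩⟩)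
    · exact isEmptyElim (α := Points .minus []) e
    · exact ⟨q₀, .inr ⟨isEmptyElim (α := (Points .plus [] ⊕ Points .minus [.plus]) ⊕ Empty), hq⟩, h⟩

theorem rel_outHalf (ω : Stream' A) (q : Q) :
    M.Rel (X := points (plus : CobH A)) (Y := points (𝟙_ (CobH A))) (outHalf ω)
      (plusState q) nilState ↔ M.AcceptsFrom q ω := by
  constructor
  · rintro ⟨j, h⟩
    obtain ⟨q₀, ⟨(a | a) | ⟨⟨⟩⟩, -, rfl⟩ | ⟨hn, -⟩, h'⟩ := h (.inr ())
    · exact h'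
    · exact isEmptyElim (α := Points .minus []) a
    -- The segment starts at the positive point, so the alternative of an initial state does not
    -- arise.
    · exact absurd rfl (hn (.inl (.inl (default : Points .plus [.plus]))))
  · refine fun h => ⟨Empty.elim, ?_⟩
    rintro (((e | e) | ⟨⟨⟩⟩) | ⟨⟩)
    · exact isEmptyElim (α := Points .minus [.plus]) e
    · exact isEmptyElim (α := Points .plus []) e
    · exact ⟨q, .inl ⟨.inl (.inl (default : Points .plus [.plus])), rfl, rfl⟩, h⟩

theorem rel_outHalf' (ω : Stream' A) (q : Q) :
    M.Rel (X := points (𝟙_ (CobH A))) (Y := points (minus : CobH A)) (outHalf' ω)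
      nilState (minusState q) ↔ M.AcceptsFrom q ω := by
  constructor
  · rintro ⟨j, h⟩
    obtain ⟨q₀, ⟨(a | a) | ⟨⟨⟩⟩, -, rfl⟩ | ⟨hn, -⟩, h'⟩ := h (.inr ())
    · exact isEmptyElim (α := Points .plus []) a
    · exact h'
    · exact absurd rfl (hn (.inl (.inr (default : Points .minus [.minus]))))
  · refine fun h => ⟨Empty.elim, ?_⟩
    rintro (((e | e) | ⟨⟨⟩⟩) | ⟨⟩)
    · exact isEmptyElim (α := Points .minus []) e
    · exact isEmptyElim (α := Points .plus [.minus]) e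
    · exact ⟨q, .inl ⟨.inl (.inr (default : Points .minus [.minus])), rfl, rfl⟩, h⟩

theorem rel_floatingInterval (ω : Stream' A) :
    M.Rel (X := points (𝟙_ (CobH A))) (Y := points (𝟙_ (CobH A))) (floatingInterval ω)
      nilState nilState ↔ M.Accepts ω := by
  constructor
  · rintro ⟨j, h⟩
    obtain ⟨q₀, ⟨a, -⟩ | ⟨-, hq⟩, h'⟩ := h (.inr ())
    · exact isEmptyElim (α := (Points .plus [] ⊕ Points .minus []) ⊕ Empty) a
    · exact ⟨q₀, hq, h'⟩
  · rintro ⟨q₀, hq, h⟩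
    refine ⟨Empty.elim, ?_⟩
    rintro (e | ⟨⟩)
    · exact isEmptyElim (α := (Points .minus [] ⊕ Points .plus []) ⊕ Empty) e
    · exact ⟨q₀, .inr ⟨isEmptyElim (α := (Points .plus [] ⊕ Points .minus []) ⊕ Empty), hq⟩, h⟩

/-- The circle is cut at one junction, where its only segment both starts and ends; the state there
is the base state of the closed path. -/
theorem rel_circle (w : List A) :
    M.Rel (X := points (𝟙_ (CobH A))) (Y := points (𝟙_ (CobH A))) (circle w)
      nilState nilState ↔ ∃ q, M.Reaches q w q := by
  constructor
  · rintro ⟨j, h⟩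
    obtain ⟨q₀, ⟨a | ⟨⟩, -, rfl⟩ | ⟨hn, -⟩, h'⟩ := h (.inl (.inr ()))
    · exact isEmptyElim (α := Points .plus [] ⊕ Points .minus []) a
    · exact ⟨_, h'⟩
    · exact absurd rfl (hn (.inr ()))
  · rintro ⟨q, h⟩
    refine ⟨fun _ => q, ?_⟩
    rintro ((e | ⟨⟩) | ⟨⟨⟩⟩)
    · exact isEmptyElim (α := Points .minus [] ⊕ Points .plus []) e
    · exact ⟨q, .inl ⟨.inr (), rfl, rfl⟩, h⟩

theorem reaches_singleton (q : Q) (a : A) (q' : Q) : M.Reaches q [a] q' ↔ q' ∈ M.trans q a := by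
  simp [Reaches]

/-! ### The Boolean TQFT in coordinates -/

variable [Finite Q]

/-- The Boolean TQFT of a Muller automaton. -/
noncomputable def booleanTQFT : BooleanTQFT A where
  functor := toPoints A ⋙ M.tqft

/-- The basis vector of a state. -/
noncomputable def basisVec {X : CobH A} (x : States Q X.points) : M.booleanTQFT.space X :=
  (Finsupp.single x 1 : States Q X.points →₀ 𝔹)

/-- The coefficient of a vector at a state. -/
def coeff {X : CobH A} (v : M.booleanTQFT.space X) (x : States Q X.points) : 𝔹 :=
  (show States Q X.points →₀ 𝔹 from v) x

theorem coeff_ext {X : CobH A} {v w : M.booleanTQFT.space X}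
    (h : ∀ x, M.coeff v x = 1 ↔ M.coeff w x = 1) : v = w :=
  finsupp_ext_iff_eq_one.2 h

theorem coeff_basisVec {X : CobH A} (x y : States Q X.points) :
    M.coeff (M.basisVec x) y = 1 ↔ y = x :=
  single_one_apply_eq_one

theorem coeff_sum {X : CobH A} {ι : Type} (s : Finset ι) (f : ι → M.booleanTQFT.space X)
    (x : States Q X.points) : M.coeff (∑ i ∈ s, f i) x = ∑ i ∈ s, M.coeff (f i) x :=
  map_sum (Finsupp.lapply (R := 𝔹) x : (States Q X.points →₀ 𝔹) →ₗ[𝔹] 𝔹) f s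

theorem coeff_lin {X Y : CobH A} (f : X ⟶ Y) (x : States Q X.points) (y : States Q Y.points) :
    M.coeff (M.booleanTQFT.lin f (M.basisVec x)) y = 1 ↔
      M.Rel (X := X.points) (Y := Y.points) f x y :=
  relMap_single_apply_eq_one _ x y

/-- The unit of the composite functor is that of `tqft` followed by the matrix of the cylinder
`nilIso`, and the empty sequence admits only one assignment. -/
theorem unit_one : M.booleanTQFT.unit 1 = M.basisVec nilState := by
  refine (congrArg (relMap _) unitEquiv_one).trans ((M.relMap_cylIso _ _ _).trans ?_)
  exact congrArg M.basisVec (eq_nilState _)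

theorem counit_unit (r : 𝔹) : M.booleanTQFT.counit (M.booleanTQFT.unit r) = r := by
  have h := congrArg (fun f => f.hom.hom r)
    (Functor.Monoidal.ε_η M.booleanTQFT.functor)
  exact h

/-- The space of the empty sequence is spanned by the single vector `unit 1`, so being a left
inverse of `unit` determines the counit. -/
theorem counit_eq_coeff (v : M.booleanTQFT.space (𝟙_ (CobH A))) :
    M.booleanTQFT.counit v = M.coeff v nilState := by
  have h : M.booleanTQFT.counit =
      (Finsupp.lapply nilState : (States Q (points (𝟙_ (CobH A))) →₀ 𝔹) →ₗ[𝔹] 𝔹) := by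
    refine linearMap_finsupp_ext fun x => ?_
    rw [eq_nilState x]
    refine (congrArg M.booleanTQFT.counit M.unit_one.symm).trans ?_
    rw [counit_unit]
    exact Finsupp.single_eq_same.symm
  rw [h]
  rfl

theorem coeff_vec {X : CobH A} (f : 𝟙_ (CobH A) ⟶ X) (x : States Q X.points) :
    M.coeff (M.booleanTQFT.vec f) x = 1 ↔
      M.Rel (X := points (𝟙_ (CobH A))) (Y := X.points) f nilState x := by
  rw [BooleanTQFT.vec, unit_one, coeff_lin]

theorem form_basisVec {X : CobH A} (f : X ⟶ 𝟙_ (CobH A)) (x : States Q X.points) :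
    M.booleanTQFT.form f (M.basisVec x) = 1 ↔
      M.Rel (X := X.points) (Y := points (𝟙_ (CobH A))) f x nilState := by
  rw [BooleanTQFT.form, LinearMap.comp_apply, counit_eq_coeff, coeff_lin]

theorem eval_eq_one (f : 𝟙_ (CobH A) ⟶ 𝟙_ (CobH A)) :
    M.booleanTQFT.eval f = 1 ↔
      M.Rel (X := points (𝟙_ (CobH A))) (Y := points (𝟙_ (CobH A))) f nilState nilState := by
  rw [BooleanTQFT.eval, unit_one, form_basisVec]

/-- The structure map is `tensorEquiv` followed by the matrix of the cylinder `appendIso`, which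
transports assignments along the bijections `pointsAppend`. -/
theorem mul_basisVec (X Y : CobH A) (x : States Q X.points) (y : States Q Y.points) :
    M.booleanTQFT.mul X Y (M.basisVec x ⊗ₜ M.basisVec y) =
      M.basisVec (X := X ⊗ Y) (Sum.elim x.1 y.1 ∘ pointsAppend .plus X.signs Y.signs,
        Sum.elim x.2 y.2 ∘ pointsAppend .minus X.signs Y.signs) := by
  refine (congrArg (relMap _) (tensorEquiv_single X.points Y.points x y)).trans ?_
  exact M.relMap_cylIso _ _ _

theorem mul_plus_minus (q q' : Q) :
    M.booleanTQFT.mul plus minus (M.basisVec (plusState q) ⊗ₜ M.basisVec (minusState q')) =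
      M.basisVec (X := plus ⊗ minus) (pairState (l := [.plus, .minus]) q q') := by
  rw [mul_basisVec]
  refine congrArg M.basisVec (Prod.ext (funext fun p => ?_) (funext fun p => ?_))
  · change Sum.elim _ _ (pointsAppend .plus [.plus] [.minus] p) = q
    rcases pointsAppend .plus [.plus] [.minus] p with p | p
    · rfl
    · exact isEmptyElim p
  · change Sum.elim _ _ (pointsAppend .minus [.plus] [.minus] p) = q'
    rcases pointsAppend .minus [.plus] [.minus] p with p | p
    · exact isEmptyElim p
    · rfl

/-- The states change places because `pairState` lists the state at the positive point first,
whatever the order of the signs. -/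
theorem mul_minus_plus (q q' : Q) :
    M.booleanTQFT.mul minus plus (M.basisVec (minusState q) ⊗ₜ M.basisVec (plusState q')) =
      M.basisVec (X := minus ⊗ plus) (pairState (l := [.minus, .plus]) q' q) := by
  rw [mul_basisVec]
  refine congrArg M.basisVec (Prod.ext (funext fun p => ?_) (funext fun p => ?_))
  · change Sum.elim _ _ (pointsAppend .plus [.minus] [.plus] p) = q'
    rcases pointsAppend .plus [.minus] [.plus] p with p | p
    · exact isEmptyElim p
    · rfl
  · change Sum.elim _ _ (pointsAppend .minus [.minus] [.plus] p) = q
    rcases pointsAppend .minus [.minus] [.plus] p with p | p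
    · rfl
    · exact isEmptyElim p

/-- The basis of `F(+)` given by the states. -/
noncomputable def basisPlus : Module.Basis Q 𝔹 (M.booleanTQFT.space plus) :=
  (Finsupp.basisSingleOne (R := 𝔹) (ι := States Q (points (plus : CobH A)))).reindex plusStateEquiv

/-- The basis of `F(-)` given by the states. -/
noncomputable def basisMinus : Module.Basis Q 𝔹 (M.booleanTQFT.space minus) :=
  (Finsupp.basisSingleOne (R := 𝔹) (ι := States Q (points (minus : CobH A)))).reindex
    minusStateEquiv

theorem basisPlus_apply (q : Q) : M.basisPlus q = M.basisVec (plusState q) :=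
  basisSingleOne_reindex_apply plusStateEquiv q

theorem basisMinus_apply (q : Q) : M.basisMinus q = M.basisVec (minusState q) :=
  basisSingleOne_reindex_apply minusStateEquiv q

theorem basisPlus_repr (v : M.booleanTQFT.space plus) (q : Q) :
    M.basisPlus.repr v q = M.coeff v (plusState q) :=
  basisSingleOne_reindex_repr plusStateEquiv v q

theorem basisMinus_repr (v : M.booleanTQFT.space minus) (q : Q) :
    M.basisMinus.repr v q = M.coeff v (minusState q) :=
  basisSingleOne_reindex_repr minusStateEquiv v q

end MullerAutomaton

end MullerTQFT

/-! ### Values of the TQFT on the elementary cobordisms -/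

theorem mainTheorem5 {A Q : Type} [Finite A] [Fintype Q] (M : MullerAutomaton A Q) :
    ∃ (F : BooleanTQFT A) (b : Module.Basis Q 𝔹 (F.space plus))
      (b' : Module.Basis Q 𝔹 (F.space minus)),
      F.vec cup = F.mul plus minus (∑ q, b q ⊗ₜ[𝔹] b' q) ∧
      (∀ q₁ q₂, F.form cap (F.mul plus minus (b q₁ ⊗ₜ[𝔹] b' q₂)) = 1 ↔ q₁ = q₂) ∧
      (∀ q₁ q₂, F.form cap' (F.mul minus plus (b' q₁ ⊗ₜ[𝔹] b q₂)) = 1 ↔ q₁ = q₂) ∧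
      (∀ a q q', b.repr (F.lin (strand .plus [a]) (b q)) q' = 1 ↔ q' ∈ M.trans q a) ∧
      (∀ a q q', b'.repr (F.lin (strand .minus [a]) (b' q')) q = 1 ↔ q' ∈ M.trans q a) ∧
      (∀ w q, b.repr (F.vec (inHalf w)) q = 1 ↔ ∃ q₀ ∈ M.init, M.Reaches q₀ w q) ∧
      (∀ ω q, F.form (outHalf ω) (b q) = 1 ↔ M.AcceptsFrom q ω) ∧
      (∀ ω q, b'.repr (F.vec (outHalf' ω)) q = 1 ↔ M.AcceptsFrom q ω) ∧
      (∀ ω, F.eval (floatingInterval ω) = 1 ↔ M.Accepts ω) ∧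
      (∀ w, F.eval (circle w) = 1 ↔ ∃ q, M.Reaches q w q) := by
  refine ⟨M.booleanTQFT, M.basisPlus, M.basisMinus, ?_, fun q₁ q₂ => ?_, fun q₁ q₂ => ?_,
    fun a q q' => ?_, fun a q q' => ?_, fun w q => ?_, fun ω q => ?_, fun ω q => ?_, fun ω => ?_,
    fun w => ?_⟩
  · refine M.coeff_ext fun y => ?_
    simp only [map_sum, M.basisPlus_apply, M.basisMinus_apply, M.mul_plus_minus, M.coeff_sum,
      𝔹.sum_eq_one, Finset.mem_univ, true_and]
    -- The sum over states has become an existential quantifier, which matches the description of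
    -- the runs along the cup.
    exact (M.coeff_vec cup y).trans ((M.rel_cup y).trans
      (exists_congr fun q => (M.coeff_basisVec _ y).symm))
  · rw [M.basisPlus_apply, M.basisMinus_apply, M.mul_plus_minus]
    exact (M.form_basisVec cap _).trans (M.rel_cap q₁ q₂)
  · rw [M.basisPlus_apply, M.basisMinus_apply, M.mul_minus_plus]
    -- The arc is read from the positive to the negative point, so the equality appears as `q₂ =
    -- q₁`.
    exact (M.form_basisVec cap' _).trans ((M.rel_cap' q₂ q₁).trans eq_comm)
  · rw [M.basisPlus_apply]
    exact (Eq.congr_left (M.basisPlus_repr _ q')).trans <| (M.coeff_lin _ _ _).trans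
      ((M.rel_strand_plus _ _ _).trans (M.reaches_singleton _ _ _))
  · rw [M.basisMinus_apply]
    exact (Eq.congr_left (M.basisMinus_repr _ q)).trans <| (M.coeff_lin _ _ _).trans
      ((M.rel_strand_minus _ _ _).trans (M.reaches_singleton _ _ _))
  · rw [M.basisPlus_repr]
    exact (M.coeff_vec _ _).trans (M.rel_inHalf w q)
  · rw [M.basisPlus_apply]
    exact (M.form_basisVec _ _).trans (M.rel_outHalf ω q)
  · rw [M.basisMinus_repr]
    exact (M.coeff_vec _ _).trans (M.rel_outHalf' ω q)
  · exact (M.eval_eq_one _).trans (M.rel_floatingInterval ω)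
  · exact (M.eval_eq_one _).trans (M.rel_circle w)
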